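/- **Trees.** A (non-planar rooted) tree is an isomorphism class of finite posets $\mathfrak t$ with a least element (the root) in which the elements below any given vertex form a chain. Let $\mathrm v(\mathfrak t)$ be the set of non-root vertices, $|\mathfrak t|=\#\mathrm v(\mathfrak t)$ the degree, $\mathbf 1$ the tree of degree $0$, and $\mathrm{SG}(\mathfrak t)$ the group of order automorphisms of $\mathrm v(\mathfrak t)$. Write $\mathfrak t_1\circ\dots\circ\mathfrak t_k$ for the tree obtained by identifying the roots; every tree decomposes uniquely into factors whose root has exactly one child. A grafting map $d$ from $\mathfrak t$ to $\mathfrak s$ assigns a vertex of $\mathfrak s$ (possibly the root) to each child of the root of $\mathfrak t$; $\mathfrak t\rightharpoonup^{d}\mathfrak s$ is the tree obtained by removing the root of $\mathfrak t$ and attaching each of its children $v$ to $d(v)$. **Labelled trees.** Let $E$ be a real Banach space whose tensor powers carry a symmetric system of cross (semi)norms, i.e. $\|a\otimes b\|=\|a\|\,\|b\|$, $\|\sigma a\|=\|a\|$ for permutations $\sigma$ of the factors, and the usual norms on $E^{\otimes 1}=E$, $E^{\otimes 0}=\mathbb R$. Let $E^{\hat\otimes k}$ be the completion of $E^{\otimes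 k}$, and $E^{\hat\otimes\mathfrak t}=E^{\hat\otimes|\mathfrak t|}/\ker(\mathrm{sym}_{\mathrm{SG}(\mathfrak t)})$, where the factors are indexed by $\mathrm v(\mathfrak t)$ and $\mathrm{sym}$ is averaging over the group; its elementary tensors are trees with vertices labelled by elements of $E$. Put $\widehat{\mathfrak{Tr}}(E)=\prod_{\mathfrak t}E^{\hat\otimes\mathfrak t}$ and let $\widehat{\mathfrak{Tr}}{}^{(N)}(E)=\prod_{|\mathfrak t|\le N}E^{\hat\otimes\mathfrak t}$ be its truncation. The Grossman–Larson product $\star$ on $\widehat{\mathfrak{Tr}}{}^{(N)}(E)$ is the continuous bilinear map with $\mathbf t\star\mathbf s=\sum_d[\mathbf t\rightharpoonup^{d}\mathbf s]$ for labelled trees, where $d$ ranges over all grafting maps and terms of degree $>N$ are dropped. The coproduct $\Delta_{\mathrm{GL}}$ on $\widehat{\mathfrak{Tr}}(E)$ is the continuous linear extension of $\Delta_{\mathrm{GL}}(\mathbf t_1\circ\dots\circ\mathbf t_k)=\sum_{I\subseteq\{1,\dots,k\}}\bigcirc_{i\in I}\mathbf t_i\otimes\bigcirc_{i\notin I}\mathbf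 t_i$, where the $\mathbf t_i$ are labelled trees whose root has one child; it takes values in the completed tensor product, the product over pairs $(\mathfrak t,\mathfrak s)$ of the completions of $E^{\otimes\mathfrak t}\otimes E^{\otimes\mathfrak s}$ in the norms induced from $E^{\otimes(|\mathfrak t|+|\mathfrak s|)}$. An element $\mathbf g$ is group-like if $\mathbf g\neq0$ and $\Delta_{\mathrm{GL}}(\mathbf g)=\mathbf g\otimes\mathbf g$. **Rough paths.** Let $T>0$, $p\ge1$, $N=\lfloor p\rfloor$ and $\Delta_T=\{(s,t):0\le s\le t\le T\}$. A control is a continuous $\omega:\Delta_T\to[0,\infty)$ with $\omega(s,s)=0$ and $\omega(s,t)+\omega(t,u)\le\omega(s,u)$ for $s\le t\le u$. A branched $p$-rough path controlled by $\omega$ is a continuous map $\mathbf x:\Delta_T\to\widehat{\mathfrak{Tr}}{}^{(N)}(E)$ such that, for $0\le s\le t\le u\le T$: $\mathbf x_{s,u}=\mathbf x_{s,t}\star\mathbf x_{t,u}$; $\mathbf x_{s,t}$ is the truncation of some group-like $\mathbf g\in\widehat{\mathfrak{Tr}}(E)$; and for $1\le k\le N$ the part of $\mathbf x_{s,t}$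 of degree $k$ has norm at most $\omega(s,t)^{k/p}$, where this part is normed by the maximum of the norms of its tree components. **The maps $\Psi$.** Let $F$ be a real Banach space and let $V:E\times F\to F$, $(e,y)\mapsto V_e(y)$, be continuous, linear in $e$, and smooth in $y$ for every fixed $e$. For a smooth map $f:F\to G$ into a Banach space and $y\in F$, define $\Psi_{V,f,y}$ on a labelled tree as follows. A vertex with label $e$ whose children carry the vectors $z_1,\dots,z_k\in F$ carries the vector $V_e^{(k)}(y)[z_1,\dots,z_k]$, and if the children of the root carry $z_1,\dots,z_m$, then $\Psi_{V,f,y}=f^{(m)}(y)[z_1,\dots,z_m]$. Extend $\Psi_{V,f,y}$ linearly and continuously to $\widehat{\mathfrak{Tr}}{}^{(N)}(E)$. For this extension, assume that at least one of the following holds: (a) for every $k\le N$ the chosen norm on $E^{\otimes k}$ is equivalent to the projective norm; (b) for every smooth $f$ into a Banach space, every tree $\mathfrak t$ with $|\mathfrak t|\le N$ and every $y_0\in F$, the linear maps $\Psi_{V,f,y}$ on $E^{\otimes|\mathfrak t|}$ are bounded for the chosen norm, uniformly for $y$ in a neighbourhood of $y_0$. **Theorem.** Under these assumptions, let $\mathbf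 x$ be a branched $p$-rough path controlled by a control $\omega$ and let $y:[0,T]\to F$ be continuous. Then the following are equivalent. (i) There is $\theta:\mathbb R\to\mathbb R$ with $\theta(h)/h\to0$ as $h\to0$ such that $\|y_t-\Psi_{V,\mathrm{id},y_s}(\mathbf x_{s,t})\|\le\theta(\omega(s,t))$ for all $(s,t)\in\Delta_T$. (ii) For every Banach space $G$ and every smooth $f:F\to G$ there is $\theta_f:\mathbb R\to\mathbb R$ with $\theta_f(h)/h\to0$ as $h\to0$ such that $\|f(y_t)-\Psi_{V,f,y_s}(\mathbf x_{s,t})\|\le\theta_f(\omega(s,t))$ for all $(s,t)\in\Delta_T$. -/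

import Mathlib

open scoped TensorProduct Topology

universe u v w

noncomputable section

namespace BranchedRough

/-! ### Non-planar rooted trees -/

/-- A finite rooted tree whose set of non-root vertices is `ι` (to be used for finite `ι`).
The root is left implicit: the tree is the poset obtained from `(ι, le)` by adjoining a least
element. The field `chain` says that the vertices below a given vertex are totally ordered. -/
@[ext]
structure RTree (ι : Type) where
  le : ι → ι → Prop
  refl : ∀ a, le a a
  trans : ∀ a b c, le a b → le b c → le a c
  antisymm : ∀ a b, le a b → le b a → a = b
  chain : ∀ v a b, le a v → le b v → le a b ∨ le b a

namespace RTree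

variable {ι κ : Type}

/-- Strict order on the non-root vertices. -/
def lt (t : RTree ι) (a b : ι) : Prop := t.le a b ∧ a ≠ b

/-- `w` is a child of the non-root vertex `v`. -/
def IsChild (t : RTree ι) (v w : ι) : Prop := t.lt v w ∧ ∀ x, ¬ (t.lt v x ∧ t.lt x w)

/-- `v` is a child of the root. -/
def IsRootChild (t : RTree ι) (v : ι) : Prop := ∀ x, ¬ t.lt x v

/-- The set of children of the root. -/
abbrev RootChild (t : RTree ι) : Type := {v : ι // t.IsRootChild v}

/-- Isomorphisms of trees: the order preserving bijections between the non-root vertices.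
For `t = s` this is the symmetry group of `t`. -/
abbrev Iso (t : RTree ι) (s : RTree κ) : Type := t.le ≃r s.le

theorem lt_trans (t : RTree ι) {a b c : ι} (hab : t.lt a b) (hbc : t.lt b c) : t.lt a c :=
  ⟨t.trans _ _ _ hab.1 hbc.1, fun h => hab.2 (t.antisymm _ _ hab.1 (h ▸ hbc.1))⟩

theorem wf_gt [Finite ι] (t : RTree ι) : WellFounded (fun b a => t.lt a b) := by
  have : IsTrans ι (fun b a => t.lt a b) := ⟨fun _ _ _ h h' => t.lt_trans h' h⟩
  have : Std.Irrefl (fun b a => t.lt a b) := ⟨fun _ h => h.2 rfl⟩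
  exact Finite.wellFounded_of_trans_of_irrefl _

theorem wf_lt [Finite ι] (t : RTree ι) : WellFounded (fun a b => t.lt a b) := by
  have : IsTrans ι (fun a b => t.lt a b) := ⟨fun _ _ _ h h' => t.lt_trans h h'⟩
  have : Std.Irrefl (fun a b => t.lt a b) := ⟨fun _ h => h.2 rfl⟩
  exact Finite.wellFounded_of_trans_of_irrefl _

theorem rootChild_unique (t : RTree ι) {a b v : ι} (ha : t.IsRootChild a) (hb : t.IsRootChild b)
    (hav : t.le a v) (hbv : t.le b v) : a = b := by
  rcases t.chain v a b hav hbv with h | h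
  · by_contra hne
    exact hb a ⟨h, hne⟩
  · by_contra hne
    exact ha b ⟨h, fun e => hne e.symm⟩

theorem child_unique (t : RTree ι) {x a b v : ι} (ha : t.IsChild x a) (hb : t.IsChild x b)
    (hav : t.le a v) (hbv : t.le b v) : a = b := by
  rcases t.chain v a b hav hbv with h | h
  · by_contra hne
    exact hb.2 a ⟨ha.1, h, hne⟩
  · by_contra hne
    exact ha.2 b ⟨hb.1, h, fun e => hne e.symm⟩

theorem exists_rootChild_le [Finite ι] (t : RTree ι) (v : ι) :
    ∃ a, t.IsRootChild a ∧ t.le a v := by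
  obtain ⟨a, hav, hmin⟩ := t.wf_lt.has_min {a | t.le a v} ⟨v, t.refl v⟩
  exact ⟨a, fun x hx => hmin x (t.trans _ _ _ hx.1 hav) hx, hav⟩

theorem exists_child_le [Finite ι] (t : RTree ι) {x v : ι} (hxv : t.lt x v) :
    ∃ a, t.IsChild x a ∧ t.le a v := by
  obtain ⟨a, hav, hmin⟩ := t.wf_lt.has_min {a | t.lt x a ∧ t.le a v} ⟨v, hxv, t.refl v⟩
  exact ⟨a, ⟨hav.1, fun z hz => hmin z ⟨hz.1, t.trans _ _ _ hz.2.1 hav.2⟩ hz.2⟩, hav.2⟩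

/-- The tree obtained by keeping the root and the vertices in `A`, with the induced order. -/
def restrict (t : RTree ι) (A : Set ι) : RTree A where
  le a b := t.le a b
  refl a := t.refl a
  trans a b c := t.trans a b c
  antisymm a b h h' := Subtype.ext (t.antisymm a b h h')
  chain v a b := t.chain v a b

/-- The vertices lying (weakly) above one of the children of the root in `I`. -/
def above (t : RTree ι) (I : Set t.RootChild) : Set ι := {v | ∃ a ∈ I, t.le a.1 v}

/-- Grafting of `t` onto `s` along `d`, which sends every child of the root of `t` to a vertex of
`s`; here `none` stands for the root of `s` and `some k` for its non-root vertex `k`. -/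
def graft (t : RTree ι) (s : RTree κ) (d : t.RootChild → Option κ) : RTree (ι ⊕ κ) where
  le
    | .inl a, .inl b => t.le a b
    | .inr a, .inr b => s.le a b
    | .inr a, .inl b => ∃ m : t.RootChild, t.le m.1 b ∧ ∃ k, d m = some k ∧ s.le a k
    | .inl _, .inr _ => False
  refl := by
    rintro (a | a)
    · exact t.refl a
    · exact s.refl a
  trans := by
    rintro (a | a) (b | b) (c | c) h h'
    · exact t.trans _ _ _ h h'
    · exact h'
    · exact h.elim
    · exact h.elim
    · obtain ⟨m, hm, hk⟩ := h
      exact ⟨m, t.trans _ _ _ hm h', hk⟩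
    · exact h'.elim
    · obtain ⟨m, hm, k, hk, hk'⟩ := h'
      exact ⟨m, hm, k, hk, s.trans _ _ _ h hk'⟩
    · exact s.trans _ _ _ h h'
  antisymm := by
    rintro (a | a) (b | b) h h'
    · exact congrArg _ (t.antisymm _ _ h h')
    · exact h.elim
    · exact h'.elim
    · exact congrArg _ (s.antisymm _ _ h h')
  chain := by
    rintro (v | v) (a | a) (b | b) h h'
    · exact t.chain v a b h h'
    · obtain ⟨m, hm, k, hk, hk'⟩ := h'
      rcases t.chain v m.1 a hm h with hma | ham
      · exact Or.inr ⟨m, hma, k, hk, hk'⟩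
      · have : a = m.1 := by
          by_contra hne
          exact m.2 a ⟨ham, hne⟩
        exact Or.inr ⟨m, this ▸ t.refl _, k, hk, hk'⟩
    · obtain ⟨m, hm, k, hk, hk'⟩ := h
      rcases t.chain v m.1 b hm h' with hmb | hbm
      · exact Or.inl ⟨m, hmb, k, hk, hk'⟩
      · have : b = m.1 := by
          by_contra hne
          exact m.2 b ⟨hbm, hne⟩
        exact Or.inl ⟨m, this ▸ t.refl _, k, hk, hk'⟩
    · obtain ⟨m, hm, k, hk, hk'⟩ := h
      obtain ⟨n, hn, l, hl, hl'⟩ := h'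
      have hmn : m = n := Subtype.ext (t.rootChild_unique m.2 n.2 hm hn)
      subst hmn
      rw [hk] at hl
      obtain rfl := Option.some.inj hl
      exact s.chain k a b hk' hl'
    · exact h.elim
    · exact h.elim
    · exact h'.elim
    · exact s.chain v a b h h'

instance [Finite ι] : Finite (RTree ι) :=
  Finite.of_injective (fun t : RTree ι => t.le) fun _ _ h => RTree.ext h

/-- Two trees with `n` non-root vertices are equivalent if they are isomorphic. -/
def isoSetoid (n : ℕ) : Setoid (RTree (Fin n)) where
  r t s := Nonempty (Iso t s)
  iseqv := ⟨fun t => ⟨RelIso.refl t.le⟩, fun ⟨e⟩ => ⟨e.symm⟩, fun ⟨e⟩ ⟨f⟩ => ⟨e.trans f⟩⟩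

end RTree

/-- The set of non-planar rooted trees: isomorphism classes of finite rooted trees. -/
def Tr : Type := Σ n : ℕ, Quotient (RTree.isoSetoid n)

namespace Tr

/-- The degree of a tree: its number of non-root vertices. -/
def deg (t : Tr) : ℕ := t.1

/-- A representative, with non-root vertices enumerated by `Fin t.deg`. -/
def rep (t : Tr) : RTree (Fin t.deg) := Quotient.out t.2

end Tr

/-- The trees of degree at most `N`. -/
abbrev TrLE (N : ℕ) : Type := {t : Tr // t.deg ≤ N}

instance (N : ℕ) : Finite (TrLE N) := by
  let g : (Σ n : Fin (N + 1), Quotient (RTree.isoSetoid n)) → TrLE N :=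
    fun q => ⟨⟨q.1, q.2⟩, Nat.le_of_lt_succ q.1.2⟩
  refine Finite.of_surjective g ?_
  rintro ⟨⟨n, q⟩, h⟩
  exact ⟨⟨⟨n, Nat.lt_succ_of_le h⟩, q⟩, rfl⟩

instance (N : ℕ) : Fintype (TrLE N) := Fintype.ofFinite _

instance {ι κ : Type} [Finite ι] [Finite κ] (t : RTree ι) (s : RTree κ) : Finite (t.Iso s) :=
  Finite.of_injective (fun e : t.Iso s => e.toEquiv) fun _ _ h => RelIso.toEquiv_injective h

instance {ι κ : Type} [Finite ι] [Finite κ] (t : RTree ι) (s : RTree κ) : Fintype (t.Iso s) :=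
  Fintype.ofFinite _

/-! ### Tensor powers with symmetric cross norms and their completions -/

section Tensor

variable (E : Type u) [NormedAddCommGroup E] [NormedSpace ℝ E]

/-- A symmetric system of cross (semi)norms on the tensor powers of `E`. The tensor factors are
indexed by arbitrary finite types; symmetry is invariance under relabelling of the factors. -/
structure CrossNorms where
  nrm : ∀ (ι : Type) [Finite ι], Seminorm ℝ (⨂[ℝ] _ : ι, E)
  nrm_one : nrm (Fin 0) (⨂ₜ[ℝ] _ : Fin 0, (0 : E)) = 1
  nrm_single : ∀ e : E, nrm (Fin 1) (⨂ₜ[ℝ] _ : Fin 1, e) = ‖e‖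
  nrm_reindex : ∀ (ι κ : Type) [Finite ι] [Finite κ] (σ : ι ≃ κ) (a : ⨂[ℝ] _ : ι, E),
    nrm κ (PiTensorProduct.reindex ℝ (fun _ => E) σ a) = nrm ι a
  nrm_cross : ∀ (ι κ : Type) [Finite ι] [Finite κ] (a : ⨂[ℝ] _ : ι, E) (b : ⨂[ℝ] _ : κ, E),
    nrm (ι ⊕ κ) (PiTensorProduct.tmulEquiv ℝ E (a ⊗ₜ[ℝ] b)) = nrm ι a * nrm κ b

variable {E}

/-- In degree `k`, the chosen cross norm is equivalent to the projective one (cross norms are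
always bounded by the projective norm). -/
def CrossNorms.ProjectiveAt (α : CrossNorms E) (k : ℕ) : Prop :=
  ∃ C : ℝ, ∀ a : ⨂[ℝ] _ : Fin k, E, PiTensorProduct.projectiveSeminorm a ≤ C * α.nrm (Fin k) a

/-- The algebraic tensor power, with factors indexed by `ι`, normed by the given system. -/
def PreTPow (_α : CrossNorms E) (ι : Type) [Finite ι] : Type u := ⨂[ℝ] _ : ι, E

variable (α : CrossNorms E) {ι κ μ : Type} [Finite ι] [Finite κ] [Finite μ]

instance : AddCommGroup (PreTPow α ι) := inferInstanceAs (AddCommGroup (⨂[ℝ] _ : ι, E))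

instance : Module ℝ (PreTPow α ι) := inferInstanceAs (Module ℝ (⨂[ℝ] _ : ι, E))

/-- The chosen seminorm. -/
def preNorm (α : CrossNorms E) (ι : Type) [Finite ι] : Seminorm ℝ (PreTPow α ι) := α.nrm ι

instance : SeminormedAddCommGroup (PreTPow α ι) :=
  AddGroupSeminorm.toSeminormedAddCommGroup (preNorm α ι).toAddGroupSeminorm

instance : NormedSpace ℝ (PreTPow α ι) where
  norm_smul_le r a := (map_smul_eq_mul (preNorm α ι) r a).le

/-- The completed tensor power of `E` with factors indexed by `ι`. -/
abbrev TPow (α : CrossNorms E) (ι : Type) [Finite ι] : Type u :=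
  UniformSpace.Completion (PreTPow α ι)

/-- Relabelling of the tensor factors, on the algebraic tensor power. -/
def preReindex (σ : ι ≃ κ) : PreTPow α ι →L[ℝ] PreTPow α κ :=
  LinearMap.mkContinuous
    (PiTensorProduct.reindex ℝ (fun _ => E) σ : (⨂[ℝ] _ : ι, E) →ₗ[ℝ] ⨂[ℝ] _ : κ, E) 1
    fun a => by
      rw [one_mul]
      exact (α.nrm_reindex ι κ σ a).le

/-- Relabelling of the tensor factors, on the completed tensor power. -/
def reindex (σ : ι ≃ κ) : TPow α ι →L[ℝ] TPow α κ := (preReindex α σ).completion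

theorem reindex_reindex (σ : ι ≃ κ) (τ : κ ≃ μ) (a : TPow α ι) :
    reindex α τ (reindex α σ a) = reindex α (σ.trans τ) a := by
  induction a using UniformSpace.Completion.induction_on with
  | hp => exact isClosed_eq (by fun_prop) (by fun_prop)
  | ih a =>
    simp only [reindex, ContinuousLinearMap.completion_apply_coe]
    congr 1
    exact PiTensorProduct.reindex_reindex σ τ a

/-- The tensor product of tensors, on algebraic tensor powers. -/
def preTmul : PreTPow α ι →ₗ[ℝ] PreTPow α κ →ₗ[ℝ] PreTPow α (ι ⊕ κ) :=
  (TensorProduct.mk ℝ (⨂[ℝ] _ : ι, E) (⨂[ℝ] _ : κ, E)).compr₂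
    (PiTensorProduct.tmulEquiv ℝ E).toLinearMap

/-- The tensor product of tensors, on completed tensor powers: the continuous bilinear extension of
the algebraic one. -/
def tmul : TPow α ι →L[ℝ] TPow α κ →L[ℝ] TPow α (ι ⊕ κ) :=
  let B : PreTPow α ι →L[ℝ] PreTPow α κ →L[ℝ] TPow α (ι ⊕ κ) :=
    LinearMap.mkContinuous₂
      ((preTmul α).compr₂ (UniformSpace.Completion.toComplL
        (𝕜 := ℝ) (E := PreTPow α (ι ⊕ κ))).toLinearMap) 1
      fun a b => by
        rw [one_mul]
        change ‖((preTmul α a b : PreTPow α (ι ⊕ κ)) : TPow α (ι ⊕ κ))‖ ≤ _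
        rw [UniformSpace.Completion.norm_coe]
        exact (α.nrm_cross ι κ a b).le
  (B.fromCompletion.flip.fromCompletion).flip

theorem tmul_coe (a : PreTPow α ι) (b : PreTPow α κ) :
    tmul α (a : TPow α ι) (b : TPow α κ) = ((preTmul α a b : PreTPow α (ι ⊕ κ)) :
      TPow α (ι ⊕ κ)) := by
  simp [tmul]

/-! ### Labelled trees -/

/-- Passage from a tensor whose factors are indexed by the vertices of the tree `t` to its class
in the labelled trees over `s`: it is zero if `s` is not isomorphic to `t`, and otherwise it is the
average over all isomorphisms from `t` to `s`. For `t = s` it is the projection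
`sym_{SG(t)}`. -/
def classTo (t : RTree ι) (s : RTree κ) : TPow α ι →L[ℝ] TPow α κ :=
  (Nat.card (t.Iso s) : ℝ)⁻¹ • ∑ φ : t.Iso s, reindex α φ.toEquiv

theorem classTo_self_classTo (t : RTree ι) (s : RTree κ) (a : TPow α ι) :
    classTo α s s (classTo α t s a) = classTo α t s a := by
  have key : ∀ σ : s.Iso s, ∑ φ : t.Iso s, reindex α σ.toEquiv (reindex α φ.toEquiv a)
      = ∑ φ : t.Iso s, reindex α φ.toEquiv a := by
    intro σ
    let m : t.Iso s ≃ t.Iso s :=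
      ⟨fun φ => φ.trans σ, fun φ => φ.trans σ.symm, fun φ => by ext; simp,
        fun φ => by ext; simp⟩
    refine Fintype.sum_equiv m _ _ fun φ => ?_
    rw [reindex_reindex]
    rfl
  have hne : (Nat.card (s.Iso s) : ℝ) ≠ 0 := by
    have : Nonempty (s.Iso s) := ⟨RelIso.refl _⟩
    exact_mod_cast Nat.card_pos.ne'
  simp only [classTo, smul_apply, sum_apply, map_smul,
    map_sum]
  congr 1
  rw [← Finset.smul_sum, Finset.sum_comm]
  simp only [key, Finset.sum_const, Finset.card_univ]
  rw [← Nat.card_eq_fintype_card, ← Nat.cast_smul_eq_nsmul ℝ (Nat.card (s.Iso s)),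
    inv_smul_smul₀ hne]

/-- The completed `t`-tensor power of `E`. The quotient of the completed tensor power by the kernel
of `sym_{SG(t)}` is realised, isometrically, as the image of that projection. -/
def TreePow (t : Tr) : Submodule ℝ (TPow α (Fin t.deg)) :=
  LinearMap.range (classTo α t.rep t.rep).toLinearMap

/-- The completed space of labelled trees: the product of the `TreePow α t` over all trees. -/
abbrev TreeAlg : Type u := ∀ t : Tr, TreePow α t

/-- The truncated space of labelled trees of degree at most `N`, with the product topology. -/
abbrev TruncTreeAlg (N : ℕ) : Type u := ∀ t : TrLE N, TreePow α t.1

/-- Truncation. -/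
def trunc (N : ℕ) (g : TreeAlg α) : TruncTreeAlg α N := fun t => g t.1

/-- The Grossman-Larson product on truncated labelled trees: the component over the tree `u` of the
sum, over all trees `t`, `s` and all grafting maps from `t` to `s`, of the classes of the
graftings of `x t` onto `y s`. -/
def star {N : ℕ} (x y : TruncTreeAlg α N) : TruncTreeAlg α N := by
  classical
  exact fun u => ⟨∑ t : TrLE N, ∑ s : TrLE N,
    letI := Fintype.ofFinite (t.1.rep.RootChild → Option (Fin s.1.deg))
    ∑ d : t.1.rep.RootChild → Option (Fin s.1.deg),
      classTo α (t.1.rep.graft s.1.rep d) u.1.rep (tmul α (x t).1 (y s).1),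
    Submodule.sum_mem _ fun _ _ => Submodule.sum_mem _ fun _ _ => Submodule.sum_mem _ fun _ _ =>
      ⟨_, classTo_self_classTo α _ _ _⟩⟩

/-- Given a tensor `a` over the tree `u` and a set of vertices `A` of `u`, the class of the
restrictions of `a` to `A` and to the complement of `A`, in the component over the pair of trees
`(t, s)` of the completed tensor product of the space of labelled trees with itself. It is zero
unless these restrictions of `u` are isomorphic to `t` and `s`. -/
def splitTo {ν : Type} [Finite ν] (u : RTree ν) (A : Set ν) (t : RTree ι) (s : RTree κ) :
    TPow α ν →L[ℝ] TPow α (ι ⊕ κ) :=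
  letI := Classical.decPred (· ∈ A)
  ((Nat.card ((u.restrict A).Iso t) : ℝ)⁻¹ * (Nat.card ((u.restrict Aᶜ).Iso s) : ℝ)⁻¹) •
    ∑ φ : (u.restrict A).Iso t, ∑ ψ : (u.restrict Aᶜ).Iso s,
      reindex α ((Equiv.Set.sumCompl A).symm.trans (Equiv.sumCongr φ.toEquiv ψ.toEquiv))

/-- The component over the pair `(t, s)` of the Grossman-Larson coproduct of `g`: the sum over all
trees `u` and all sets `I` of children of the root of `u` (that is, over all ways to distribute the
factors in the decomposition of `u` with respect to the product that merges roots). -/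
def coproductGL (g : TreeAlg α) (t s : Tr) : TPow α (Fin t.deg ⊕ Fin s.deg) :=
  ∑ u : TrLE (t.deg + s.deg),
    letI := Fintype.ofFinite (Set u.1.rep.RootChild)
    ∑ I : Set u.1.rep.RootChild, splitTo α u.1.rep (u.1.rep.above I) t.rep s.rep (g u.1).1

/-- Group-like elements: `g ≠ 0` and `Δ g = g ⊗ g`. -/
def IsGroupLike (g : TreeAlg α) : Prop :=
  g ≠ 0 ∧ ∀ t s : Tr, coproductGL α g t s = tmul α (g t).1 (g s).1

end Tensor

/-! ### Controls and branched rough paths -/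

/-- The simplex `{(s, t) : 0 ≤ s ≤ t ≤ T}`. -/
def simplex (T : ℝ) : Set (ℝ × ℝ) := {q | 0 ≤ q.1 ∧ q.1 ≤ q.2 ∧ q.2 ≤ T}

/-- Control functions on `[0, T]`. -/
structure IsControl (T : ℝ) (ω : ℝ → ℝ → ℝ) : Prop where
  continuousOn : ContinuousOn (fun q : ℝ × ℝ => ω q.1 q.2) (simplex T)
  nonneg : ∀ s t, 0 ≤ s → s ≤ t → t ≤ T → 0 ≤ ω s t
  diag : ∀ s, 0 ≤ s → s ≤ T → ω s s = 0
  superadditive : ∀ s t r, 0 ≤ s → s ≤ t → t ≤ r → r ≤ T → ω s t + ω t r ≤ ω s r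

/-- Branched `p`-rough paths controlled by `ω`. The bound is on the homogeneous part of degree `k`,
normed by the maximum of the norms of its (finitely many) tree components. -/
structure IsBranchedRoughPath {E : Type u} [NormedAddCommGroup E] [NormedSpace ℝ E]
    (α : CrossNorms E) (T p : ℝ) (ω : ℝ → ℝ → ℝ) (x : ℝ → ℝ → TruncTreeAlg α ⌊p⌋₊) : Prop where
  continuousOn : ContinuousOn (fun q : ℝ × ℝ => x q.1 q.2) (simplex T)
  chen : ∀ s t r, 0 ≤ s → s ≤ t → t ≤ r → r ≤ T → x s r = star α (x s t) (x t r)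
  groupLike : ∀ s t, 0 ≤ s → s ≤ t → t ≤ T → ∃ g : TreeAlg α, IsGroupLike α g ∧
    x s t = trunc α ⌊p⌋₊ g
  bound : ∀ s t, 0 ≤ s → s ≤ t → t ≤ T → ∀ k : ℕ, 1 ≤ k → k ≤ ⌊p⌋₊ →
    ∀ τ : TrLE ⌊p⌋₊, τ.1.deg = k → ‖x s t τ‖ ≤ ω s t ^ ((k : ℝ) / p)

/-! ### Vector fields and elementary differentials -/

/-- Continuous maps `E × F → F` which are linear in the first and smooth in the second argument. -/
structure VectorFields (E : Type u) (F : Type v) [NormedAddCommGroup E] [NormedSpace ℝ E]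
    [NormedAddCommGroup F] [NormedSpace ℝ F] where
  toLin : E →ₗ[ℝ] F → F
  continuous : Continuous fun q : E × F => toLin q.1 q.2
  smooth : ∀ e, ContDiff ℝ (⊤ : ℕ∞) (toLin e)

section Psi

variable {E : Type u} {F : Type v} {G : Type w} [NormedAddCommGroup E] [NormedSpace ℝ E]
  [NormedAddCommGroup F] [NormedSpace ℝ F] [NormedAddCommGroup G] [NormedSpace ℝ G]
  {ι : Type} [Finite ι]

/-- The derivative of `g` at `y`, of order the number of elements of the finite set `C` (given by a
predicate), applied to the vectors `z c` for `c` in `C`. By symmetry of the derivative of a smooth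
`g`, the enumeration of `C` is irrelevant. -/
def derivAlong (g : F → G) (y : F) (C : ι → Prop) (z : ∀ c, C c → F) : G :=
  iteratedFDeriv ℝ (Nat.card {c // C c}) g y
    fun i => z ((Finite.equivFin {c // C c}).symm i).1 ((Finite.equivFin {c // C c}).symm i).2

/-- The vector attached to the vertex `a` of the tree `t` labelled by `e`: the derivative of
the vector field `V (e a)` at `y`, applied to the vectors attached to the children of `a`. -/
def vertexVec (V : VectorFields E F) (y : F) (t : RTree ι) (e : ι → E) : ι → F :=
  t.wf_gt.fix fun a rec => derivAlong (V.toLin (e a)) y (t.IsChild a) fun c hc => rec c hc.1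

theorem vertexVec_eq (V : VectorFields E F) (y : F) (t : RTree ι) (e : ι → E) (a : ι) :
    vertexVec V y t e a =
      derivAlong (V.toLin (e a)) y (t.IsChild a) fun c _ => vertexVec V y t e c :=
  t.wf_gt.fix_eq _ a

/-- The elementary differential: the derivative of `f` at `y` applied to the vectors attached to
the children of the root of `t`. -/
def elemDiff (V : VectorFields E F) (f : F → G) (y : F) (t : RTree ι) (e : ι → E) : G :=
  derivAlong f y t.IsRootChild fun c _ => vertexVec V y t e c

theorem derivAlong_congr (g : F → G) (y : F) (C : ι → Prop) {z z' : ι → F}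
    (h : ∀ c, C c → z c = z' c) :
    derivAlong g y C (fun c _ => z c) = derivAlong g y C (fun c _ => z' c) := by
  unfold derivAlong
  congr 1
  funext i
  exact h _ ((Finite.equivFin {c // C c}).symm i).2

theorem derivAlong_eq_update (g : F → G) (y : F) (C : ι → Prop) {z z' : ι → F} {c₀ : ι}
    (h₀ : C c₀) (h : ∀ c, C c → c ≠ c₀ → z c = z' c) :
    derivAlong g y C (fun c _ => z c) = iteratedFDeriv ℝ (Nat.card {c // C c}) g y
      (Function.update (fun i => z' ((Finite.equivFin {c // C c}).symm i).1)
        (Finite.equivFin {c // C c} ⟨c₀, h₀⟩) (z c₀)) := by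
  unfold derivAlong
  congr 1
  funext i
  by_cases hi : i = Finite.equivFin {c // C c} ⟨c₀, h₀⟩
  · subst hi
    simp
  · rw [Function.update_of_ne hi]
    refine h _ ((Finite.equivFin {c // C c}).symm i).2 fun hc => hi ?_
    rw [← (Finite.equivFin {c // C c}).apply_symm_apply i]
    congr 1
    exact Subtype.ext hc

theorem derivAlong_add (g : F → G) (y : F) (C : ι → Prop) {z z₁ z₂ : ι → F} {c₀ : ι}
    (h₀ : C c₀) (h₁ : ∀ c, C c → c ≠ c₀ → z₁ c = z c) (h₂ : ∀ c, C c → c ≠ c₀ → z₂ c = z c)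
    (hz : z c₀ = z₁ c₀ + z₂ c₀) :
    derivAlong g y C (fun c _ => z c) =
      derivAlong g y C (fun c _ => z₁ c) + derivAlong g y C (fun c _ => z₂ c) := by
  rw [derivAlong_eq_update g y C (z := z) (z' := z) h₀ (fun _ _ _ => rfl),
    derivAlong_eq_update g y C h₀ h₁, derivAlong_eq_update g y C h₀ h₂, hz,
    ContinuousMultilinearMap.map_update_add]

theorem derivAlong_smul (g : F → G) (y : F) (C : ι → Prop) {z z₁ : ι → F} {c₀ : ι} {r : ℝ}
    (h₀ : C c₀) (h₁ : ∀ c, C c → c ≠ c₀ → z₁ c = z c) (hz : z c₀ = r • z₁ c₀) :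
    derivAlong g y C (fun c _ => z c) = r • derivAlong g y C (fun c _ => z₁ c) := by
  rw [derivAlong_eq_update g y C (z := z) (z' := z) h₀ (fun _ _ _ => rfl),
    derivAlong_eq_update g y C h₀ h₁, hz, ContinuousMultilinearMap.map_update_smul]

/-- The vector attached to `a` only depends on the labels of the vertices above `a`. -/
theorem vertexVec_congr (V : VectorFields E F) (y : F) (t : RTree ι) {e e' : ι → E} (a : ι) :
    (∀ b, t.le a b → e b = e' b) → vertexVec V y t e a = vertexVec V y t e' a := by
  induction a using t.wf_gt.induction with
  | h a ih =>
    intro h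
    rw [vertexVec_eq, vertexVec_eq, h a (t.refl a)]
    exact derivAlong_congr _ _ _ fun c hc =>
      ih c hc.1 fun b hb => h b (t.trans _ _ _ hc.1.1 hb)

theorem vertexVec_update [DecidableEq ι] (V : VectorFields E F) (y : F) (t : RTree ι)
    (e : ι → E) (b a : ι) (m m' : E) (h : ¬ t.le a b) :
    vertexVec V y t (Function.update e b m) a = vertexVec V y t (Function.update e b m') a :=
  vertexVec_congr V y t a fun c hc => by
    have : c ≠ b := fun hcb => h (hcb ▸ hc)
    simp [Function.update_of_ne this]

theorem vertexVec_add [DecidableEq ι] (V : VectorFields E F) (y : F) (t : RTree ι)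
    (e : ι → E) (b : ι) (m m' : E) (a : ι) : t.le a b →
    vertexVec V y t (Function.update e b (m + m')) a =
      vertexVec V y t (Function.update e b m) a + vertexVec V y t (Function.update e b m') a := by
  induction a using t.wf_gt.induction with
  | h a ih =>
    intro hab
    rw [vertexVec_eq, vertexVec_eq, vertexVec_eq]
    by_cases h : a = b
    · subst h
      have hc : ∀ c, t.IsChild a c → ¬ t.le c a := fun c hc hca =>
        hc.1.2 (t.antisymm _ _ hc.1.1 hca)
      rw [derivAlong_congr _ y _ (fun c h => vertexVec_update V y t e a c (m + m') m (hc c h)),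
        derivAlong_congr (V.toLin (Function.update e a m' a)) y _
          (fun c h => vertexVec_update V y t e a c m' m (hc c h))]
      simp only [Function.update_self, map_add, derivAlong]
      rw [iteratedFDeriv_add_apply ((V.smooth m).contDiffAt.of_le (by exact_mod_cast le_top))
        ((V.smooth m').contDiffAt.of_le (by exact_mod_cast le_top))]
      rfl
    · simp only [Function.update_of_ne h]
      obtain ⟨c₀, hc₀, hle⟩ := t.exists_child_le ⟨hab, h⟩
      have hc : ∀ c, t.IsChild a c → c ≠ c₀ → ¬ t.le c b := fun c hc hne hcb =>
        hne (t.child_unique hc hc₀ hcb hle)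
      exact derivAlong_add _ _ _ hc₀ (fun c h h' => vertexVec_update V y t e b c _ _ (hc c h h'))
        (fun c h h' => vertexVec_update V y t e b c _ _ (hc c h h')) (ih c₀ hc₀.1 hle)

theorem vertexVec_smul [DecidableEq ι] (V : VectorFields E F) (y : F) (t : RTree ι)
    (e : ι → E) (b : ι) (r : ℝ) (m : E) (a : ι) : t.le a b →
    vertexVec V y t (Function.update e b (r • m)) a =
      r • vertexVec V y t (Function.update e b m) a := by
  induction a using t.wf_gt.induction with
  | h a ih =>
    intro hab
    rw [vertexVec_eq, vertexVec_eq]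
    by_cases h : a = b
    · subst h
      have hc : ∀ c, t.IsChild a c → ¬ t.le c a := fun c hc hca =>
        hc.1.2 (t.antisymm _ _ hc.1.1 hca)
      rw [derivAlong_congr _ y _ (fun c h => vertexVec_update V y t e a c (r • m) m (hc c h))]
      simp only [Function.update_self, map_smul, derivAlong]
      rw [iteratedFDeriv_const_smul_apply
        ((V.smooth m).contDiffAt.of_le (by exact_mod_cast le_top))]
      rfl
    · simp only [Function.update_of_ne h]
      obtain ⟨c₀, hc₀, hle⟩ := t.exists_child_le ⟨hab, h⟩
      have hc : ∀ c, t.IsChild a c → c ≠ c₀ → ¬ t.le c b := fun c hc hne hcb =>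
        hne (t.child_unique hc hc₀ hcb hle)
      exact derivAlong_smul _ _ _ hc₀ (fun c h h' => vertexVec_update V y t e b c _ _ (hc c h h'))
        (ih c₀ hc₀.1 hle)

/-- The elementary differential as a multilinear map of the labels. -/
def elemDiffMulti (V : VectorFields E F) (f : F → G) (y : F) (t : RTree ι) :
    MultilinearMap ℝ (fun _ : ι => E) G where
  toFun e := elemDiff V f y t e
  map_update_add' := by
    intro _ e b m m'
    obtain ⟨c₀, hc₀, hle⟩ := t.exists_rootChild_le b
    have hc : ∀ c, t.IsRootChild c → c ≠ c₀ → ¬ t.le c b := fun c hc hne hcb =>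
      hne (t.rootChild_unique hc hc₀ hcb hle)
    exact derivAlong_add _ _ _ hc₀ (fun c h h' => vertexVec_update V y t e b c _ _ (hc c h h'))
      (fun c h h' => vertexVec_update V y t e b c _ _ (hc c h h'))
      (vertexVec_add V y t e b m m' c₀ hle)
  map_update_smul' := by
    intro _ e b r m
    obtain ⟨c₀, hc₀, hle⟩ := t.exists_rootChild_le b
    have hc : ∀ c, t.IsRootChild c → c ≠ c₀ → ¬ t.le c b := fun c hc hne hcb =>
      hne (t.rootChild_unique hc hc₀ hcb hle)
    exact derivAlong_smul _ _ _ hc₀ (fun c h h' => vertexVec_update V y t e b c _ _ (hc c h h'))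
      (vertexVec_smul V y t e b r m c₀ hle)

/-- The linear map on the algebraic tensor power given by the elementary differentials. -/
def prePsi (α : CrossNorms E) (V : VectorFields E F) (f : F → G) (y : F) (t : RTree ι) :
    PreTPow α ι →ₗ[ℝ] G :=
  (PiTensorProduct.lift (elemDiffMulti V f y t) : (⨂[ℝ] _ : ι, E) →ₗ[ℝ] G)

/-- The continuous linear extension of `prePsi` to the completed tensor power (meaningful only
if `prePsi` is bounded). -/
def psiTree [CompleteSpace G] (α : CrossNorms E) (V : VectorFields E F) (f : F → G) (y : F)
    (t : RTree ι) : TPow α ι →L[ℝ] G :=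
  LinearMap.extendOfNorm (prePsi α V f y t)
    (UniformSpace.Completion.toComplL (𝕜 := ℝ) (E := PreTPow α ι)).toLinearMap

/-- The map `Ψ_{V,f,y}` on truncated labelled trees. -/
def Psi [CompleteSpace G] (α : CrossNorms E) {N : ℕ} (V : VectorFields E F) (f : F → G) (y : F)
    (x : TruncTreeAlg α N) : G :=
  ∑ t : TrLE N, psiTree α V f y t.1.rep (x t).1

end Psi

/-- For every Banach space `G` and every smooth `f : F → G`, the maps `Ψ_{V,f,y}` are bounded on
algebraic labelled trees of degree at most `N`, locally uniformly in `y`, with respect to the cross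
norms `α`; in particular they extend to the completions. -/
def PsiBounded {E : Type u} {F : Type v} [NormedAddCommGroup E] [NormedSpace ℝ E]
    [NormedAddCommGroup F] [NormedSpace ℝ F] (α : CrossNorms E) (V : VectorFields E F)
    (N : ℕ) : Prop :=
  ∀ (G : Type (max v w)) [NormedAddCommGroup G] [NormedSpace ℝ G] [CompleteSpace G] (f : F → G),
    ContDiff ℝ (⊤ : ℕ∞) f → ∀ (t : TrLE N) (y₀ : F), ∃ C : ℝ, ∀ᶠ y in 𝓝 y₀,
      ∀ a : PreTPow α (Fin t.1.deg), ‖prePsi α V f y t.1.rep a‖ ≤ C * ‖a‖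

end BranchedRough

end

/-!
Both expansions compare a value at time `t` with a map evaluated on `x s t`, the
truncation of a group-like element, so the point is to relate `Ψ_{V,f,y}` to `Ψ_{V,id,y}` on
truncated group-like elements. Sort the trees by the number `m` of children of the root. Trees without
non-root vertices contribute `f y`, because a group-like element has unit component of degree zero
(`IsGroupLike.eq_one`). Writing `Ψ_{V,id,y}(g) = y + Z`, the increment `Z` is the contribution of
the trees with `m = 1`. Evaluating `Δ g = g ⊗ g` against elementary differentials and splitting off
one of the `m + 1` branches at the root gives the recursion `psiPart_succ`: `m + 1` times the part
of `Ψ_{V,f,y}(g)` with `m + 1` branches equals the part of `Ψ_{V,Df,y}(g)` with `m` branches,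
applied to `Z`, up to truncation. As `Df` is again a smooth map into a Banach space, induction on
`m` (`exists_norm_psiPart_sub_le`) shows that the part with `m` branches is the Taylor term
`D^m f(y)[Z, …, Z] / m!` up to terms of degree greater than `N`, which are of order
`ω(s,t)^((N+1)/p) = o(ω(s,t))`. Taylor's formula then gives
`Ψ_{V,f,y}(g) = f (Ψ_{V,id,y}(g)) + o(ω(s,t))` (`exists_norm_sub_Psi_le`), and the forward
implication follows because `f` is Lipschitz near the compact range of `y`. The converse is the
case `f = id`.

The estimates have to be uniform over base points in the range of `y`. Under the projective norm
hypothesis this follows from the uniform boundedness principle applied to the derivatives of the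
vector fields as linear maps of the label (`VectorFields.exists_bound`); under the other hypothesis
it is a covering argument.
-/

noncomputable section

namespace BranchedRough

/-! ### Symmetry of higher derivatives -/

section Derivatives

variable {F : Type v} {G : Type w} [NormedAddCommGroup F] [NormedSpace ℝ F]
  [NormedAddCommGroup G] [NormedSpace ℝ G]

theorem contDiff_top_fderiv {f : F → G} (hf : ContDiff ℝ (⊤ : ℕ∞) f) :
    ContDiff ℝ (⊤ : ℕ∞) (fderiv ℝ f) :=
  hf.fderiv_right (by norm_cast)

theorem contDiff_iteratedFDeriv_apply {f : F → G} (hf : ContDiff ℝ (⊤ : ℕ∞) f) (n : ℕ)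
    (m : Fin n → F) : ContDiff ℝ (⊤ : ℕ∞) fun x => iteratedFDeriv ℝ n f x m :=
  (ContinuousMultilinearMap.apply ℝ (fun _ : Fin n => F) G m).contDiff.comp
    (hf.iteratedFDeriv_right (by norm_cast))

theorem iteratedFDeriv_succ_eq_fderiv_apply {f : F → G} (hf : ContDiff ℝ (⊤ : ℕ∞) f) (n : ℕ)
    (x : F) (m : Fin (n + 1) → F) :
    iteratedFDeriv ℝ (n + 1) f x m =
      fderiv ℝ (fun x => iteratedFDeriv ℝ n f x (Fin.tail m)) x (m 0) := by
  have hd : DifferentiableAt ℝ (iteratedFDeriv ℝ n f) x :=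
    (hf.iteratedFDeriv_right (m := (⊤ : ℕ∞)) (by norm_cast)).contDiffAt.differentiableAt
      (by simp)
  have := (ContinuousMultilinearMap.apply ℝ (fun _ : Fin n => F) G (Fin.tail m)).hasFDerivAt.comp x
    hd.hasFDerivAt
  rw [iteratedFDeriv_succ_apply_left]
  exact (congrArg (fun L => L (m 0)) this.fderiv).symm

/-- Mathlib has the symmetry of all higher derivatives for analytic functions and that of the second
derivative for smooth ones. For smooth functions the former follows from the latter, since adjacent
transpositions generate the symmetric group. -/
theorem iteratedFDeriv_comp_swap {f : F → G} (hf : ContDiff ℝ (⊤ : ℕ∞) f) (n : ℕ) :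
    ∀ (x : F) (m : Fin (n + 1) → F) (i : Fin n),
      iteratedFDeriv ℝ (n + 1) f x (m ∘ Equiv.swap i.castSucc i.succ) =
        iteratedFDeriv ℝ (n + 1) f x m := by
  induction n with
  | zero => exact fun _ _ i => i.elim0
  | succ n ih =>
    intro x m i
    cases i using Fin.cases with
    | zero =>
      set h : F → G := fun x => iteratedFDeriv ℝ n f x (Fin.tail (Fin.tail m)) with hh
      have hs : ContDiff ℝ (⊤ : ℕ∞) h := contDiff_iteratedFDeriv_apply hf n _
      -- the two outermost derivatives of an `(n + 2)`-nd derivative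
      have key : ∀ m' : Fin (n + 2) → F, Fin.tail (Fin.tail m') = Fin.tail (Fin.tail m) →
          iteratedFDeriv ℝ (n + 2) f x m' = fderiv ℝ (fderiv ℝ h) x (m' 0) (m' 1) := by
        intro m' hm'
        have hd : DifferentiableAt ℝ (fderiv ℝ h) x :=
          (contDiff_top_fderiv hs).contDiffAt.differentiableAt (by simp)
        have := (ContinuousLinearMap.apply ℝ G (m' 1)).hasFDerivAt.comp x hd.hasFDerivAt
        rw [iteratedFDeriv_succ_eq_fderiv_apply hf]
        simp only [iteratedFDeriv_succ_eq_fderiv_apply hf n, hm', ← hh]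
        exact congrArg (fun L => L (m' 0)) this.fderiv
      rw [key m rfl, key (m ∘ _)]
      · have := (hs.contDiffAt (x := x)).isSymmSndFDerivAt (by
            rw [minSmoothness_of_isRCLikeNormedField]
            exact WithTop.coe_le_coe.2 (le_top : (2 : ℕ∞) ≤ ⊤))
        simpa using this.eq (m 1) (m 0)
      · funext j
        change m (Equiv.swap _ _ j.succ.succ) = m j.succ.succ
        rw [Equiv.swap_apply_of_ne_of_ne (by simp [Fin.ext_iff]) (by simp [Fin.ext_iff])]
    | succ i =>
      rw [iteratedFDeriv_succ_eq_fderiv_apply hf, iteratedFDeriv_succ_eq_fderiv_apply hf]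
      have htail : Fin.tail (m ∘ Equiv.swap i.succ.castSucc i.succ.succ) =
          Fin.tail m ∘ Equiv.swap i.castSucc i.succ := by
        funext j
        change m (Equiv.swap i.castSucc.succ i.succ.succ j.succ) = m (Equiv.swap _ _ j).succ
        rw [← (Fin.succ_injective _).map_swap]
      have h0 : (m ∘ Equiv.swap i.succ.castSucc i.succ.succ) 0 = m 0 := by
        change m (Equiv.swap _ _ 0) = m 0
        rw [Equiv.swap_apply_of_ne_of_ne (by simp [Fin.ext_iff]) (by simp [Fin.ext_iff])]
      rw [htail, h0]
      simp only [ih]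

theorem iteratedFDeriv_comp_perm {f : F → G} (hf : ContDiff ℝ (⊤ : ℕ∞) f) (x : F) {n : ℕ}
    (m : Fin n → F) (σ : Equiv.Perm (Fin n)) :
    iteratedFDeriv ℝ n f x (m ∘ σ) = iteratedFDeriv ℝ n f x m := by
  cases n with
  | zero => congr 1; funext i; exact i.elim0
  | succ n =>
    have hσ : σ ∈ Submonoid.closure
        (Set.range fun i : Fin n => Equiv.swap i.castSucc i.succ) := by
      rw [Equiv.Perm.mclosure_swap_castSucc_succ]; trivial
    induction hσ using Submonoid.closure_induction generalizing m with
    | mem τ hτ =>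
      obtain ⟨i, rfl⟩ := hτ
      exact iteratedFDeriv_comp_swap hf n x m i
    | one => rfl
    | mul a b _ _ ha hb =>
      rw [Equiv.Perm.coe_mul, ← Function.comp_assoc, hb, ha]

end Derivatives

section DerivAlong

variable {E : Type u} {F : Type v} {G : Type w} [NormedAddCommGroup E] [NormedSpace ℝ E]
  [NormedAddCommGroup F] [NormedSpace ℝ F] [NormedAddCommGroup G] [NormedSpace ℝ G]
  {ι κ : Type} [Finite ι] [Finite κ]

/-- The derivative along a finite set may be computed with any enumeration of that set. -/
theorem derivAlong_eq {g : F → G} (hg : ContDiff ℝ (⊤ : ℕ∞) g) (y : F) {C : ι → Prop}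
    (z : ∀ c, C c → F) {n : ℕ} (e : Fin n ≃ {c // C c}) :
    derivAlong g y C z = iteratedFDeriv ℝ n g y fun i => z (e i).1 (e i).2 := by
  have hn : Nat.card {c // C c} = n := by simpa using Nat.card_congr e.symm
  subst hn
  rw [derivAlong, ← iteratedFDeriv_comp_perm hg y _
    (e.trans (Finite.equivFin {c // C c}))]
  congr 1
  funext i
  simp

theorem derivAlong_transfer {g : F → G} (hg : ContDiff ℝ (⊤ : ℕ∞) g) (y : F) {C : ι → Prop}
    {D : κ → Prop} {z : ι → F} {w : κ → F} (e : {c // C c} ≃ {d // D d})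
    (h : ∀ c, z c.1 = w (e c).1) :
    derivAlong g y C (fun c _ => z c) = derivAlong g y D (fun d _ => w d) := by
  rw [derivAlong_eq hg y _ (Finite.equivFin {c // C c}).symm,
    derivAlong_eq hg y _ ((Finite.equivFin {c // C c}).symm.trans e)]
  simp [h]

/-- Splitting off one direction of differentiation: if `C` is `D` together with one more element,
the derivative along `C` is that of `fderiv ℝ g` along `D`, applied to the extra direction. -/
theorem derivAlong_option {g : F → G} (hg : ContDiff ℝ (⊤ : ℕ∞) g) (y : F) {C : ι → Prop}
    {D : κ → Prop} {z : ι → F} {w : κ → F} (e : Option {d // D d} ≃ {c // C c})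
    (h : ∀ d, z (e (some d)).1 = w d.1) :
    derivAlong g y C (fun c _ => z c) =
      derivAlong (fderiv ℝ g) y D (fun d _ => w d) (z (e none).1) := by
  let ε := (Finite.equivFin {d // D d}).symm
  rw [derivAlong_eq hg y _ (finSuccEquivLast.trans ((Equiv.optionCongr ε).trans e)),
    derivAlong_eq (contDiff_top_fderiv hg) y _ ε, iteratedFDeriv_succ_apply_right]
  simp [Fin.init_def, h]

end DerivAlong

/-! ### Trees: merging roots, and counting the children of the root -/

namespace RTree

variable {ι κ : Type}

/-- The tree `t ∘ s` obtained by identifying the roots of `t` and `s`. -/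
def merge (t : RTree ι) (s : RTree κ) : RTree (ι ⊕ κ) := t.graft s fun _ => none

/-- The number of children of the root. -/
def rootDeg (t : RTree ι) : ℕ := Nat.card t.RootChild

section

variable (t : RTree ι) (s : RTree κ)

@[simp] theorem merge_le_inl_inl (a b : ι) : (t.merge s).le (.inl a) (.inl b) ↔ t.le a b := Iff.rfl

@[simp] theorem merge_le_inr_inr (a b : κ) : (t.merge s).le (.inr a) (.inr b) ↔ s.le a b := Iff.rfl

@[simp] theorem merge_le_inl_inr (a : ι) (b : κ) : ¬ (t.merge s).le (.inl a) (.inr b) := id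

@[simp] theorem merge_le_inr_inl (a : κ) (b : ι) : ¬ (t.merge s).le (.inr a) (.inl b) := by
  rintro ⟨m, -, k, hk, -⟩
  cases hk

theorem merge_isChild_inl (a : ι) (d : ι ⊕ κ) :
    (t.merge s).IsChild (.inl a) d ↔ ∃ c, t.IsChild a c ∧ .inl c = d := by
  rcases d with d | d <;> simp [IsChild, lt]

theorem merge_isChild_inr (a : κ) (d : ι ⊕ κ) :
    (t.merge s).IsChild (.inr a) d ↔ ∃ c, s.IsChild a c ∧ .inr c = d := by
  rcases d with d | d <;> simp [IsChild, lt]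

@[simp] theorem merge_isRootChild_inl (a : ι) :
    (t.merge s).IsRootChild (.inl a) ↔ t.IsRootChild a := by
  simp [IsRootChild, lt]

@[simp] theorem merge_isRootChild_inr (a : κ) :
    (t.merge s).IsRootChild (.inr a) ↔ s.IsRootChild a := by
  simp [IsRootChild, lt]

end

variable {t : RTree ι} {s : RTree κ}

theorem Iso.lt_iff (φ : t.Iso s) (a b : ι) : s.lt (φ a) (φ b) ↔ t.lt a b := by
  simp only [lt, φ.map_rel_iff, ne_eq, φ.injective.eq_iff]

theorem Iso.isChild_iff (φ : t.Iso s) (a c : ι) : s.IsChild (φ a) (φ c) ↔ t.IsChild a c := by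
  simp only [IsChild, φ.surjective.forall, Iso.lt_iff]

theorem Iso.isRootChild_iff (φ : t.Iso s) (a : ι) : s.IsRootChild (φ a) ↔ t.IsRootChild a := by
  simp only [IsRootChild, φ.surjective.forall, Iso.lt_iff]

/-- An isomorphism of trees restricts to the children of the roots. -/
def Iso.rootChildEquiv (φ : t.Iso s) : t.RootChild ≃ s.RootChild :=
  φ.toEquiv.subtypeEquiv fun a => (Iso.isRootChild_iff φ a).symm

theorem Iso.rootDeg_eq (φ : t.Iso s) : t.rootDeg = s.rootDeg :=
  Nat.card_congr (Iso.rootChildEquiv φ)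

theorem rootDeg_eq_zero_iff [Finite ι] : t.rootDeg = 0 ↔ IsEmpty ι := by
  rw [rootDeg, Finite.card_eq_zero_iff]
  refine ⟨fun h => ⟨fun v => ?_⟩, fun h => ⟨fun v => h.false v.1⟩⟩
  obtain ⟨a, ha, -⟩ := t.exists_rootChild_le v
  exact h.false ⟨a, ha⟩

theorem exists_rootChild_of_rootDeg_eq_one (h : t.rootDeg = 1) :
    ∃ c, t.IsRootChild c ∧ ∀ d, t.IsRootChild d → d = c := by
  obtain ⟨hs, ⟨c⟩⟩ := Nat.card_eq_one_iff_unique.1 h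
  exact ⟨c.1, c.2, fun d hd => congrArg Subtype.val (hs.elim ⟨d, hd⟩ c)⟩

end RTree

/-! ### Elementary differentials of isomorphic and of merged trees -/

section ElemDiff

variable {E : Type u} {F : Type v} {G : Type w} [NormedAddCommGroup E] [NormedSpace ℝ E]
  [NormedAddCommGroup F] [NormedSpace ℝ F] [NormedAddCommGroup G] [NormedSpace ℝ G]
  {ι κ : Type} [Finite ι] [Finite κ] (V : VectorFields E F) (y : F)

/-- Vertex vectors are preserved by injections onto a set of vertices closed under passing to
children. -/
theorem vertexVec_comp {t : RTree ι} {s : RTree κ} {φ : ι → κ} (hφ : Function.Injective φ)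
    (h : ∀ a d, s.IsChild (φ a) d ↔ ∃ c, t.IsChild a c ∧ φ c = d) (e : κ → E) (a : ι) :
    vertexVec V y s e (φ a) = vertexVec V y t (e ∘ φ) a := by
  induction a using t.wf_gt.induction with
  | h a ih =>
    rw [vertexVec_eq, vertexVec_eq]
    let ε : {c // t.IsChild a c} ≃ {d // s.IsChild (φ a) d} :=
      Equiv.ofBijective (fun c => ⟨φ c.1, (h _ _).2 ⟨c.1, c.2, rfl⟩⟩)
        ⟨fun c d hcd => Subtype.ext (hφ (congrArg Subtype.val hcd)), fun d => by
          obtain ⟨c, hc, hcd⟩ := (h _ _).1 d.2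
          exact ⟨⟨c, hc⟩, Subtype.ext hcd⟩⟩
    exact (derivAlong_transfer (V.smooth _) y ε fun c => (ih c.1 c.2.1).symm).symm

theorem elemDiff_iso {f : F → G} (hf : ContDiff ℝ (⊤ : ℕ∞) f) {t : RTree ι}
    {s : RTree κ} (φ : t.Iso s) (e : κ → E) :
    elemDiff V f y s e = elemDiff V f y t (e ∘ φ) := by
  refine (derivAlong_transfer hf y (RTree.Iso.rootChildEquiv φ) fun c => ?_).symm
  refine (vertexVec_comp V y φ.injective (fun a d => ?_) e c.1).symm
  obtain ⟨d, rfl⟩ := φ.surjective d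
  simp [RTree.Iso.isChild_iff, φ.injective.eq_iff]

theorem elemDiff_of_rootDeg_eq_zero {f : F → G} (hf : ContDiff ℝ (⊤ : ℕ∞) f)
    {t : RTree ι} (ht : t.rootDeg = 0) (e : ι → E) :
    elemDiff V f y t e = f y := by
  have : IsEmpty t.RootChild := Finite.card_eq_zero_iff.1 ht
  rw [elemDiff, derivAlong_eq hf y _ (Equiv.equivOfIsEmpty (Fin 0) _)]
  simp

/-- If the root of `t` has one child, merging `t` with `s` and differentiating `f` amounts to
contracting the elementary differential of `fderiv ℝ f` along `s` with that of `id` along `t`. -/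
theorem elemDiff_merge {f : F → G} (hf : ContDiff ℝ (⊤ : ℕ∞) f) {t : RTree ι}
    (s : RTree κ) (ht : t.rootDeg = 1) (e : ι → E) (e' : κ → E) :
    elemDiff V f y (t.merge s) (Sum.elim e e') =
      elemDiff V (fderiv ℝ f) y s e' (elemDiff V id y t e) := by
  obtain ⟨c, hc, hcu⟩ := RTree.exists_rootChild_of_rootDeg_eq_one ht
  have hid : elemDiff V id y t e = vertexVec V y t e c := by
    let ε : Fin 1 ≃ {d // t.IsRootChild d} :=
      Equiv.ofBijective (fun _ => ⟨c, hc⟩)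
        ⟨fun i j _ => Subsingleton.elim i j, fun d => ⟨0, Subtype.ext (hcu d.1 d.2).symm⟩⟩
    rw [elemDiff, derivAlong_eq contDiff_id y _ ε]
    rw [iteratedFDeriv_one_apply, fderiv_id]
    rfl
  let ε : Option {d // s.IsRootChild d} ≃ {d // (t.merge s).IsRootChild d} :=
    Equiv.ofBijective (fun o => o.elim ⟨.inl c, by simpa⟩ fun d => ⟨.inr d.1, by simpa using d.2⟩)
      ⟨by rintro (_ | a) (_ | b) h <;> simp_all [Subtype.ext_iff], by
        rintro ⟨d | d, hd⟩
        · exact ⟨none, by simp [hcu d (by simpa using hd)]⟩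
        · exact ⟨some ⟨d, by simpa using hd⟩, rfl⟩⟩
  rw [hid, elemDiff, derivAlong_option hf y (D := s.IsRootChild) (w := vertexVec V y s e') ε]
  · change derivAlong (fderiv ℝ f) y s.IsRootChild (fun d _ => vertexVec V y s e' d)
      (vertexVec V y (t.merge s) (Sum.elim e e') (.inl c)) = _
    rw [vertexVec_comp V y Sum.inl_injective (t.merge_isChild_inl s) (Sum.elim e e') c,
      Sum.elim_comp_inl]
    rfl
  · intro d
    change vertexVec V y (t.merge s) (Sum.elim e e') (.inr d.1) = _
    rw [vertexVec_comp V y Sum.inr_injective (t.merge_isChild_inr s) (Sum.elim e e') d.1,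
      Sum.elim_comp_inr]

theorem elemDiff_id_of_two_le {t : RTree ι} (ht : 2 ≤ t.rootDeg) (e : ι → E) :
    elemDiff V (id : F → F) y t e = 0 := by
  obtain ⟨n, hn⟩ := Nat.exists_eq_add_of_le' ht
  let ε : Fin (n + 1 + 1) ≃ t.RootChild := (finCongr hn.symm).trans (Finite.equivFin _).symm
  rw [elemDiff, derivAlong_eq contDiff_id y _ ε, iteratedFDeriv_succ_apply_right]
  have : (fun y : F => fderiv ℝ id y) = fun _ => ContinuousLinearMap.id ℝ F := by
    funext y
    exact fderiv_id
  rw [this, iteratedFDeriv_const_of_ne (Nat.succ_ne_zero n)]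
  rfl

end ElemDiff

/-! ### Continuous extensions of elementary differentials -/

section PsiTree

variable {E : Type u} {F : Type v} {G : Type w} [NormedAddCommGroup E] [NormedSpace ℝ E]
  [NormedAddCommGroup F] [NormedSpace ℝ F] [NormedAddCommGroup G] [NormedSpace ℝ G]
  {ι κ : Type} [Finite ι] [Finite κ] (α : CrossNorms E) (V : VectorFields E F)

/-- Boundedness of the elementary differential of `f` along `t` on the algebraic tensor power. -/
def PsiBdd (f : F → G) (y : F) (t : RTree ι) : Prop :=
  ∃ C : ℝ, ∀ a : PreTPow α ι, ‖prePsi α V f y t a‖ ≤ C * ‖a‖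

/-- Elementary tensors: trees with labelled vertices. -/
def preTprod (e : ι → E) : PreTPow α ι := (PiTensorProduct.tprod ℝ e : ⨂[ℝ] _ : ι, E)

theorem prePsi_tprod (f : F → G) (y : F) (t : RTree ι) (e : ι → E) :
    prePsi α V f y t (preTprod α e) = elemDiff V f y t e :=
  PiTensorProduct.lift.tprod e

theorem preReindex_tprod (σ : ι ≃ κ) (e : ι → E) :
    preReindex α σ (preTprod α e) = preTprod α (e ∘ σ.symm) :=
  PiTensorProduct.reindex_tprod σ e

theorem preTmul_tprod (e : ι → E) (e' : κ → E) :
    preTmul α (preTprod α e) (preTprod α e') = preTprod α (Sum.elim e e') :=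
  PiTensorProduct.tmulEquiv_apply ℝ E e e'

theorem preTPow_ext {M : Type*} [AddCommGroup M] [Module ℝ M] {L L' : PreTPow α ι →ₗ[ℝ] M}
    (h : ∀ e : ι → E, L (preTprod α e) = L' (preTprod α e)) : L = L' :=
  PiTensorProduct.ext (MultilinearMap.ext h)

theorem denseRange_toComplL : DenseRange
    (UniformSpace.Completion.toComplL (𝕜 := ℝ) (E := PreTPow α ι)).toLinearMap :=
  UniformSpace.Completion.denseRange_coe

theorem norm_preReindex (σ : ι ≃ κ) (a : PreTPow α ι) : ‖preReindex α σ a‖ = ‖a‖ :=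
  α.nrm_reindex ι κ σ a

theorem prePsi_preReindex {f : F → G} (hf : ContDiff ℝ (⊤ : ℕ∞) f) (y : F) {t : RTree ι}
    {s : RTree κ} (φ : t.Iso s) (a : PreTPow α ι) :
    prePsi α V f y s (preReindex α φ.toEquiv a) = prePsi α V f y t a := by
  have : (prePsi α V f y s).comp (preReindex α φ.toEquiv).toLinearMap = prePsi α V f y t := by
    refine preTPow_ext α fun e => ?_
    change prePsi α V f y s (preReindex α φ.toEquiv (preTprod α e)) = _
    rw [preReindex_tprod, prePsi_tprod, prePsi_tprod, elemDiff_iso V y hf φ]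
    congr 1
    funext i
    exact congrArg e (φ.toEquiv.symm_apply_apply i)
  exact LinearMap.congr_fun this a

theorem prePsi_preTmul {f : F → G} (hf : ContDiff ℝ (⊤ : ℕ∞) f) (y : F) {t : RTree ι}
    (ht : t.rootDeg = 1) (s : RTree κ) (a : PreTPow α ι) (b : PreTPow α κ) :
    prePsi α V f y (t.merge s) (preTmul α a b) =
      prePsi α V (fderiv ℝ f) y s b (prePsi α V id y t a) := by
  have h₁ : ∀ e : ι → E, (prePsi α V f y (t.merge s)).comp (preTmul α (preTprod α e)) =
      (ContinuousLinearMap.apply ℝ G (elemDiff V id y t e)).toLinearMap.comp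
        (prePsi α V (fderiv ℝ f) y s) := fun e => by
    refine preTPow_ext α fun e' => ?_
    change prePsi α V f y (t.merge s) (preTmul α (preTprod α e) (preTprod α e')) =
      prePsi α V (fderiv ℝ f) y s (preTprod α e') (elemDiff V id y t e)
    rw [preTmul_tprod, prePsi_tprod, prePsi_tprod, elemDiff_merge V y hf s ht]
  have h₂ : (prePsi α V f y (t.merge s)).comp ((preTmul α).flip b) =
      (prePsi α V (fderiv ℝ f) y s b).toLinearMap.comp (prePsi α V id y t) := by
    refine preTPow_ext α fun e => ?_
    refine (LinearMap.congr_fun (h₁ e) b).trans ?_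
    change _ = prePsi α V (fderiv ℝ f) y s b (prePsi α V id y t (preTprod α e))
    rw [prePsi_tprod]
    rfl
  exact LinearMap.congr_fun h₂ a

theorem PsiBdd.iso {f : F → G} (hf : ContDiff ℝ (⊤ : ℕ∞) f) {y : F} {t : RTree ι}
    {s : RTree κ} (φ : t.Iso s) (h : PsiBdd α V f y t) : PsiBdd α V f y s := by
  obtain ⟨C, hC⟩ := h
  refine ⟨C, fun a => ?_⟩
  have := hC (preReindex α (RelIso.symm φ).toEquiv a)
  rwa [prePsi_preReindex α V hf y (RelIso.symm φ), norm_preReindex] at this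

section

variable [CompleteSpace G]

theorem psiTree_coe {f : F → G} {y : F} {t : RTree ι} (h : PsiBdd α V f y t) (a : PreTPow α ι) :
    psiTree α V f y t (a : TPow α ι) = prePsi α V f y t a := by
  refine LinearMap.extendOfNorm_eq (denseRange_toComplL α) ?_ a
  obtain ⟨C, hC⟩ := h
  exact ⟨C, fun a => (hC a).trans_eq (by congr 1; exact (UniformSpace.Completion.norm_coe a).symm)⟩

theorem norm_psiTree_le {f : F → G} {y : F} {t : RTree ι} {C : ℝ}
    (h : ∀ a : PreTPow α ι, ‖prePsi α V f y t a‖ ≤ C * ‖a‖) (a : TPow α ι) :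
    ‖psiTree α V f y t a‖ ≤ C * ‖a‖ :=
  LinearMap.norm_extendOfNorm_apply_le (denseRange_toComplL α) C (fun a => (h a).trans_eq
    (by congr 1; exact (UniformSpace.Completion.norm_coe a).symm)) a

theorem psiTree_reindex {f : F → G} (hf : ContDiff ℝ (⊤ : ℕ∞) f) {y : F} {t : RTree ι}
    {s : RTree κ} (φ : t.Iso s) (h : PsiBdd α V f y t) (a : TPow α ι) :
    psiTree α V f y s (reindex α φ.toEquiv a) = psiTree α V f y t a := by
  induction a using UniformSpace.Completion.induction_on with
  | hp => exact isClosed_eq (by fun_prop) (by fun_prop)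
  | ih a =>
    rw [reindex, ContinuousLinearMap.completion_apply_coe, psiTree_coe α V h,
      psiTree_coe α V (h.iso α V hf φ), prePsi_preReindex α V hf]

theorem psiTree_eq_zero {f : F → G} {y : F} {t : RTree ι} (h : ∀ e, elemDiff V f y t e = 0)
    (a : TPow α ι) : psiTree α V f y t a = 0 := by
  have h0 : prePsi α V f y t = 0 := preTPow_ext α fun e => (prePsi_tprod α V f y t e).trans (h e)
  have := norm_psiTree_le α V (f := f) (y := y) (t := t) (C := 0) (fun a => by simp [h0]) a
  simpa using this

/-- Multiplicativity over merged roots, when the root of the first tree has one child. -/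
theorem psiTree_tmul [CompleteSpace F] {f : F → G} (hf : ContDiff ℝ (⊤ : ℕ∞) f) {y : F}
    {t : RTree ι} (ht : t.rootDeg = 1) {s : RTree κ} (h : PsiBdd α V f y (t.merge s))
    (hid : PsiBdd α V id y t) (hs : PsiBdd α V (fderiv ℝ f) y s) (a : TPow α ι) (b : TPow α κ) :
    psiTree α V f y (t.merge s) (tmul α a b) =
      psiTree α V (fderiv ℝ f) y s b (psiTree α V id y t a) := by
  induction a, b using UniformSpace.Completion.induction_on₂ with
  | hp => exact isClosed_eq (by fun_prop) (by fun_prop)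
  | ih a b =>
    rw [tmul_coe, psiTree_coe α V h, psiTree_coe α V hid, psiTree_coe α V hs,
      prePsi_preTmul α V hf y ht]

end

end PsiTree

/-! ### Splitting a tree at its root -/

section Split

variable {ι κ μ : Type}

theorem RTree.mem_above_of_le {t : RTree ι} {I : Set t.RootChild} {a b : ι} (h : t.le a b) :
    a ∈ t.above I ↔ b ∈ t.above I := by
  constructor
  · rintro ⟨c, hc, hca⟩
    exact ⟨c, hc, t.trans _ _ _ hca h⟩
  · rintro ⟨c, hc, hcb⟩
    rcases t.chain b a c.1 h hcb with hac | hca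
    · refine ⟨c, hc, ?_⟩
      by_cases hne : a = c.1
      · exact hne ▸ t.refl _
      · exact (c.2 a ⟨hac, hne⟩).elim
    · exact ⟨c, hc, hca⟩

/-- The relabelling used in the coproduct is an isomorphism onto the merged tree. -/
def RTree.splitIso {u : RTree μ} (I : Set u.RootChild)
    [DecidablePred (· ∈ u.above I)] {t : RTree ι}
    {s : RTree κ} (φ : (u.restrict (u.above I)).Iso t) (ψ : (u.restrict (u.above I)ᶜ).Iso s) :
    u.Iso (t.merge s) where
  toEquiv := (Equiv.Set.sumCompl (u.above I)).symm.trans (Equiv.sumCongr φ.toEquiv ψ.toEquiv)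
  map_rel_iff' := by
    intro a b
    simp only [Equiv.trans_apply]
    by_cases ha : a ∈ u.above I <;> by_cases hb : b ∈ u.above I
    · rw [Equiv.Set.sumCompl_symm_apply_of_mem ha, Equiv.Set.sumCompl_symm_apply_of_mem hb]
      exact φ.map_rel_iff
    · rw [Equiv.Set.sumCompl_symm_apply_of_mem ha, Equiv.Set.sumCompl_symm_apply_of_notMem hb]
      exact iff_of_false (merge_le_inl_inr _ _ _ _) fun h => hb ((mem_above_of_le h).1 ha)
    · rw [Equiv.Set.sumCompl_symm_apply_of_notMem ha, Equiv.Set.sumCompl_symm_apply_of_mem hb]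
      exact iff_of_false (merge_le_inr_inl _ _ _ _) fun h => ha ((mem_above_of_le h).2 hb)
    · rw [Equiv.Set.sumCompl_symm_apply_of_notMem ha, Equiv.Set.sumCompl_symm_apply_of_notMem hb]
      exact ψ.map_rel_iff

open Classical in
/-- The average of a constant family indexed by two finite types; it vanishes if one of them is
empty, since `0⁻¹ = 0`. -/
theorem average_const {A B M : Type*} [Fintype A] [Fintype B] [AddCommGroup M] [Module ℝ M]
    {w : A → B → M} (X : M) (h : ∀ φ ψ, w φ ψ = X) :
    ((Nat.card A : ℝ)⁻¹ * (Nat.card B : ℝ)⁻¹) • ∑ φ : A, ∑ ψ : B, w φ ψ =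
      if Nonempty A ∧ Nonempty B then X else 0 := by
  have hsum : ∑ φ : A, ∑ ψ : B, w φ ψ = ((Nat.card A : ℝ) * (Nat.card B : ℝ)) • X := by
    simp only [h, Finset.sum_const, Finset.card_univ, smul_smul, ← Nat.card_eq_fintype_card]
    rw [← Nat.cast_smul_eq_nsmul ℝ, Nat.cast_mul]
  rw [hsum, smul_smul, ← mul_inv]
  split_ifs with hn
  · obtain ⟨_, _⟩ := hn
    rw [inv_mul_cancel₀, one_smul]
    exact mul_ne_zero (by exact_mod_cast Nat.card_pos.ne') (by exact_mod_cast Nat.card_pos.ne')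
  · rw [not_and_or, not_nonempty_iff, not_nonempty_iff] at hn
    rcases hn with hn | hn <;> simp

variable {E : Type u} {F : Type v} {G : Type w} [NormedAddCommGroup E] [NormedSpace ℝ E]
  [NormedAddCommGroup F] [NormedSpace ℝ F] [NormedAddCommGroup G] [NormedSpace ℝ G]
  [Finite ι] [Finite κ] [Finite μ]

open Classical in
/-- Evaluating a component of the coproduct against the elementary differential along the merged
tree recovers the elementary differential of the original tree. -/
theorem psiTree_splitTo [CompleteSpace G] (α : CrossNorms E) (V : VectorFields E F) {f : F → G}
    (hf : ContDiff ℝ (⊤ : ℕ∞) f) {y : F} {u : RTree μ} (h : PsiBdd α V f y u)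
    (I : Set u.RootChild) (t : RTree ι) (s : RTree κ) (a : TPow α μ) :
    psiTree α V f y (t.merge s) (splitTo α u (u.above I) t s a) =
      if Nonempty ((u.restrict (u.above I)).Iso t) ∧ Nonempty ((u.restrict (u.above I)ᶜ).Iso s)
      then psiTree α V f y u a else 0 := by
  have key : ∀ (φ : (u.restrict (u.above I)).Iso t) (ψ : (u.restrict (u.above I)ᶜ).Iso s),
      psiTree α V f y (t.merge s) (reindex α ((Equiv.Set.sumCompl (u.above I)).symm.trans
        (Equiv.sumCongr φ.toEquiv ψ.toEquiv)) a) = psiTree α V f y u a := fun φ ψ =>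
    psiTree_reindex α V hf (RTree.splitIso I φ ψ) h a
  simp only [splitTo, smul_apply, sum_apply, map_smul, map_sum]
  exact average_const _ key

end Split

/-! ### Isomorphism classes of trees -/

namespace RTree

variable {ι κ : Type}

/-- Transport of a tree structure along a bijection. -/
def transport (t : RTree ι) (e : ι ≃ κ) : RTree κ where
  le a b := t.le (e.symm a) (e.symm b)
  refl _ := t.refl _
  trans _ _ _ := t.trans _ _ _
  antisymm _ _ h h' := e.symm.injective (t.antisymm _ _ h h')
  chain _ _ _ := t.chain _ _ _

theorem exists_iso_rep [Finite ι] (t : RTree ι) : ∃ τ : Tr, Nonempty (t.Iso τ.rep) := by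
  let e := Finite.equivFin ι
  let q : Quotient (isoSetoid (Nat.card ι)) := ⟦t.transport e⟧
  have h₁ : t.Iso (t.transport e) :=
    { toEquiv := e
      map_rel_iff' := by
        intro a b
        change t.le (e.symm (e a)) (e.symm (e b)) ↔ _
        simp }
  obtain ⟨h₂⟩ : Nonempty ((Quotient.out q).Iso (t.transport e)) :=
    Quotient.mk_out (s := isoSetoid _) (t.transport e)
  exact ⟨⟨_, q⟩, ⟨h₁.trans h₂.symm⟩⟩

theorem rep_injective {σ τ : Tr} (h : Nonempty (σ.rep.Iso τ.rep)) : σ = τ := by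
  obtain ⟨n, q⟩ := σ
  obtain ⟨m, r⟩ := τ
  obtain ⟨φ⟩ := h
  have hnm : n = m := by simpa [Tr.deg] using Nat.card_congr φ.toEquiv
  subst hnm
  exact congrArg (Sigma.mk n) (Quotient.out_equiv_out (s := isoSetoid n).1 ⟨φ⟩)

theorem rootDeg_merge [Finite ι] [Finite κ] (t : RTree ι) (s : RTree κ) :
    (t.merge s).rootDeg = t.rootDeg + s.rootDeg := by
  rw [rootDeg, Nat.card_congr (Equiv.subtypeSum)]
  simp [Nat.card_sum, rootDeg]

theorem rootDeg_restrict_above (u : RTree ι) (I : Set u.RootChild) :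
    (u.restrict (u.above I)).rootDeg = Nat.card I := by
  symm
  refine Nat.card_congr (Equiv.ofBijective (fun c => ⟨⟨c.1.1, c.1, c.2, u.refl _⟩, fun x hx =>
    c.1.2 x.1 ⟨hx.1, fun h => hx.2 (Subtype.ext h)⟩⟩) ⟨fun c d h => ?_, ?_⟩)
  · simpa [Subtype.ext_iff] using h
  · rintro ⟨⟨r, c, hc, hcr⟩, hr⟩
    refine ⟨⟨c, hc⟩, ?_⟩
    by_contra hne
    exact hr ⟨c.1, c, hc, u.refl _⟩ ⟨hcr, fun h => hne (Subtype.ext h)⟩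

end RTree

theorem sum_trLE_eq {M : Type*} [AddCommMonoid M] {k N : ℕ} (hk : k ≤ N) {h : Tr → M}
    (h0 : ∀ u : Tr, u.deg ≠ k → h u = 0) : ∑ u : TrLE k, h u.1 = ∑ u : TrLE N, h u.1 := by
  refine Fintype.sum_of_injective (fun u : TrLE k => (⟨u.1, u.2.trans hk⟩ : TrLE N))
    (fun u v huv => Subtype.ext (congrArg (fun w : TrLE N => w.1) huv)) _ _ (fun u hu => h0 _ ?_)
    fun _ => rfl
  intro hd
  exact hu ⟨⟨u.1, hd.le⟩, rfl⟩

open Classical in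
theorem sum_singletons {R M : Type*} [Fintype R] [Fintype (Set R)] [AddCommMonoid M] (X : M) :
    ∑ I : Set R, (if Nat.card I = 1 then X else 0) = Nat.card R • X := by
  rw [Nat.card_eq_fintype_card, ← Finset.card_univ, ← Finset.sum_const]
  refine (Fintype.sum_of_injective (fun c : R => ({c} : Set R)) Set.singleton_injective _ _
    (fun I hI => if_neg fun h => hI ?_) fun c => by simp).symm
  rw [Nat.card_coe_set_eq, Set.ncard_eq_one] at h
  obtain ⟨c, rfl⟩ := h
  exact ⟨c, rfl⟩

open Classical in
/-- Among all pairs of trees, exactly one is formed of the two parts into which a set of children of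
the root splits a given tree. -/
theorem sum_split_parts {M : Type*} [AddCommMonoid M] {N : ℕ} (u : TrLE N)
    (I : Set u.1.rep.RootChild) (m L : ℕ) (X : M) :
    ∑ t : TrLE N, ∑ s : TrLE N,
      (if t.1.rep.rootDeg = 1 ∧ s.1.rep.rootDeg = m ∧ t.1.deg + s.1.deg < L then
        (if Nonempty ((u.1.rep.restrict (u.1.rep.above I)).Iso t.1.rep) ∧
          Nonempty ((u.1.rep.restrict (u.1.rep.above I)ᶜ).Iso s.1.rep) then X else 0) else 0) =
      if Nat.card I = 1 then (if u.1.rep.rootDeg = m + 1 ∧ u.1.deg < L then X else 0) else 0 := by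
  obtain ⟨t, ⟨φ⟩⟩ := (u.1.rep.restrict (u.1.rep.above I)).exists_iso_rep
  obtain ⟨s, ⟨ψ⟩⟩ := (u.1.rep.restrict (u.1.rep.above I)ᶜ).exists_iso_rep
  have χ := RTree.splitIso I φ ψ
  have hdeg : u.1.deg = t.deg + s.deg := by simpa using Nat.card_congr χ.toEquiv
  have hroot : u.1.rep.rootDeg = t.rep.rootDeg + s.rep.rootDeg := by
    rw [RTree.Iso.rootDeg_eq χ, RTree.rootDeg_merge]
  have hI : t.rep.rootDeg = Nat.card I := by
    rw [← RTree.Iso.rootDeg_eq φ, RTree.rootDeg_restrict_above]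
  have hu := u.2
  have ht : ∀ t' : Tr, Nonempty ((u.1.rep.restrict (u.1.rep.above I)).Iso t'.rep) → t' = t :=
    fun t' ⟨φ'⟩ => RTree.rep_injective ⟨φ'.symm.trans φ⟩
  have hs : ∀ s' : Tr, Nonempty ((u.1.rep.restrict (u.1.rep.above I)ᶜ).Iso s'.rep) → s' = s :=
    fun s' ⟨ψ'⟩ => RTree.rep_injective ⟨ψ'.symm.trans ψ⟩
  rw [Fintype.sum_eq_single (⟨t, by omega⟩ : TrLE N),
    Fintype.sum_eq_single (⟨s, by omega⟩ : TrLE N)]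
  · have hne : Nonempty ((u.1.rep.restrict (u.1.rep.above I)).Iso t.rep) ∧
        Nonempty ((u.1.rep.restrict (u.1.rep.above I)ᶜ).Iso s.rep) := ⟨⟨φ⟩, ⟨ψ⟩⟩
    rw [if_pos hne, ← hI, hroot, hdeg]
    by_cases h : t.rep.rootDeg = 1
    · simp [h, Nat.add_comm 1]
    · simp [h]
  · intro s' hs'
    rw [ite_eq_right_iff]
    exact fun _ => if_neg fun h => hs' (Subtype.ext (hs _ h.2))
  · intro t' ht'
    refine Finset.sum_eq_zero fun s' _ => ?_
    rw [ite_eq_right_iff]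
    exact fun _ => if_neg fun h => ht' (Subtype.ext (ht _ h.1))

/-! ### The elementary differentials of a group-like element -/

section GroupLike

variable {E : Type u} {F : Type v} {G : Type w} [NormedAddCommGroup E] [NormedSpace ℝ E]
  [NormedAddCommGroup F] [NormedSpace ℝ F] [CompleteSpace F] [NormedAddCommGroup G]
  [NormedSpace ℝ G] [CompleteSpace G] (α : CrossNorms E) (V : VectorFields E F)

open Classical in
/-- The part of `Ψ_{V,f,y}(g)` coming from the trees of degree less than `L` whose root has exactly
`m` children. -/
def psiPart (N : ℕ) (f : F → G) (y : F) (g : TreeAlg α) (m L : ℕ) : G :=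
  ∑ u : TrLE N, if u.1.rep.rootDeg = m ∧ u.1.deg < L then psiTree α V f y u.1.rep (g u.1).1 else 0

/-- The recursion behind the expansion of `Ψ_{V,f,y}` on group-like elements: splitting off one of
the `m + 1` branches at the root turns a derivative of `f` into one of `fderiv ℝ f`. -/
theorem psiPart_succ {N : ℕ} {f : F → G} (hf : ContDiff ℝ (⊤ : ℕ∞) f) {y : F}
    (hB : ∀ u : TrLE N, PsiBdd α V f y u.1.rep) (hid : ∀ u : TrLE N, PsiBdd α V id y u.1.rep)
    (hB' : ∀ u : TrLE N, PsiBdd α V (fderiv ℝ f) y u.1.rep) {g : TreeAlg α}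
    (hg : IsGroupLike α g) (m L : ℕ) (hL : L ≤ N + 1) :
    (m + 1) • psiPart α V N f y g (m + 1) L =
      ∑ t : TrLE N, if t.1.rep.rootDeg = 1 then
        psiPart α V N (fderiv ℝ f) y g m (L - t.1.deg) (psiTree α V id y t.1.rep (g t.1).1)
        else 0 := by
  classical
  have hterm : ∀ t s : TrLE N, t.1.rep.rootDeg = 1 → t.1.deg + s.1.deg < L →
      psiTree α V (fderiv ℝ f) y s.1.rep (g s.1).1 (psiTree α V id y t.1.rep (g t.1).1) =
      ∑ u : TrLE N, ∑ I : Set u.1.rep.RootChild,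
        if Nonempty ((u.1.rep.restrict (u.1.rep.above I)).Iso t.1.rep) ∧
          Nonempty ((u.1.rep.restrict (u.1.rep.above I)ᶜ).Iso s.1.rep)
        then psiTree α V f y u.1.rep (g u.1).1 else 0 := by
    intro t s ht hts
    have hmerge : PsiBdd α V f y (t.1.rep.merge s.1.rep) := by
      obtain ⟨τ, ⟨φ⟩⟩ := (t.1.rep.merge s.1.rep).exists_iso_rep
      have : t.1.deg + s.1.deg = τ.deg := by simpa using Nat.card_congr φ.toEquiv
      exact (hB ⟨τ, by omega⟩).iso α V hf φ.symm
    rw [← psiTree_tmul α V hf ht hmerge (hid t) (hB' s), ← hg.2, coproductGL, map_sum]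
    rw [← sum_trLE_eq (M := G) (k := t.1.deg + s.1.deg) (by omega) (h := fun u : Tr =>
      ∑ I : Set u.rep.RootChild,
        if Nonempty ((u.rep.restrict (u.rep.above I)).Iso t.1.rep) ∧
          Nonempty ((u.rep.restrict (u.rep.above I)ᶜ).Iso s.1.rep)
        then psiTree α V f y u.rep (g u).1 else 0)]
    · refine Finset.sum_congr rfl fun u _ => ?_
      rw [map_sum]
      refine Finset.sum_congr (by ext; simp only [Finset.mem_univ]) fun I _ => ?_
      rw [psiTree_splitTo α V hf (hB ⟨u.1, by have := u.2; omega⟩)]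
    · intro u hu
      refine Finset.sum_eq_zero fun I _ => ?_
      rw [if_neg]
      rintro ⟨⟨φ⟩, ⟨ψ⟩⟩
      exact hu (by simpa using Nat.card_congr (RTree.splitIso I φ ψ).toEquiv)
  calc (m + 1) • psiPart α V N f y g (m + 1) L
      = ∑ u : TrLE N, ∑ I : Set u.1.rep.RootChild, if Nat.card I = 1 then
          (if u.1.rep.rootDeg = m + 1 ∧ u.1.deg < L then psiTree α V f y u.1.rep (g u.1).1
            else 0) else 0 := by
        rw [psiPart, Finset.smul_sum]
        refine Fintype.sum_congr _ _ fun u => ?_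
        rw [sum_singletons]
        by_cases h : u.1.rep.rootDeg = m + 1 ∧ u.1.deg < L
        · rw [if_pos h, ← h.1]; rfl
        · simp [h]
    _ = ∑ t : TrLE N, ∑ s : TrLE N, ∑ u : TrLE N, ∑ I : Set u.1.rep.RootChild,
          (if t.1.rep.rootDeg = 1 ∧ s.1.rep.rootDeg = m ∧ t.1.deg + s.1.deg < L then
          (if Nonempty ((u.1.rep.restrict (u.1.rep.above I)).Iso t.1.rep) ∧
            Nonempty ((u.1.rep.restrict (u.1.rep.above I)ᶜ).Iso s.1.rep)
            then psiTree α V f y u.1.rep (g u.1).1 else 0) else 0) := by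
        simp_rw [← sum_split_parts]
        exact (Fintype.sum_congr _ _ fun u => Finset.sum_comm.trans
          (Fintype.sum_congr _ _ fun t => Finset.sum_comm)).trans
          (Finset.sum_comm.trans (Fintype.sum_congr _ _ fun t => Finset.sum_comm))
    _ = _ := by
        refine Fintype.sum_congr _ _ fun t => ?_
        by_cases ht : t.1.rep.rootDeg = 1
        · rw [if_pos ht, psiPart, sum_apply]
          refine Fintype.sum_congr _ _ fun s => ?_
          by_cases hs : s.1.rep.rootDeg = m ∧ t.1.deg + s.1.deg < L
          · rw [if_pos ⟨hs.1, by omega⟩, hterm t s ht hs.2]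
            simp only [ht, hs, and_self, if_true]
          · rw [if_neg (fun h => hs ⟨h.1, by omega⟩)]
            simp [hs]
        · simp [ht]

end GroupLike

/-! ### Group-like elements are normalised -/

section Normalisation

variable {E : Type u} [NormedAddCommGroup E] [NormedSpace ℝ E] (α : CrossNorms E)
  {ι κ : Type} [Finite ι] [Finite κ]

theorem reindex_refl (a : TPow α ι) : reindex α (Equiv.refl ι) a = a := by
  induction a using UniformSpace.Completion.induction_on with
  | hp => exact isClosed_eq (by fun_prop) (by fun_prop)
  | ih a =>
    rw [reindex, ContinuousLinearMap.completion_apply_coe]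
    congr 1
    exact LinearEquiv.congr_fun (PiTensorProduct.reindex_refl (R := ℝ) (s := fun _ : ι => E)) a

theorem reindex_injective (σ : ι ≃ κ) : Function.Injective (reindex α σ) :=
  Function.LeftInverse.injective (g := reindex α σ.symm) fun a => by
    rw [reindex_reindex, Equiv.self_trans_symm, reindex_refl]

/-- Elements of `TreePow α t` are invariant under the symmetries of `t`. -/
theorem reindex_of_mem_treePow {t : Tr} {a : TPow α (Fin t.deg)} (ha : a ∈ TreePow α t)
    (σ : t.rep.Iso t.rep) : reindex α σ.toEquiv a = a := by
  obtain ⟨b, rfl⟩ := ha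
  change reindex α σ.toEquiv (classTo α t.rep t.rep b) = classTo α t.rep t.rep b
  simp only [classTo, smul_apply, sum_apply, map_smul, map_sum]
  congr 1
  let m : t.rep.Iso t.rep ≃ t.rep.Iso t.rep :=
    ⟨fun φ => φ.trans σ, fun φ => φ.trans σ.symm, fun φ => by ext; simp, fun φ => by ext; simp⟩
  refine Fintype.sum_equiv m _ _ fun φ => ?_
  rw [reindex_reindex]
  rfl

/-- The completed tensor power over an empty index type is spanned by the empty tensor. -/
theorem exists_smul_preTprod_of_isEmpty [IsEmpty ι] (e : ι → E) (a : TPow α ι) :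
    ∃ c : ℝ, a = c • ((preTprod α e : PreTPow α ι) : TPow α ι) := by
  let S : Submodule ℝ (TPow α ι) := ℝ ∙ ((preTprod α e : PreTPow α ι) : TPow α ι)
  suffices a ∈ S by
    obtain ⟨c, hc⟩ := Submodule.mem_span_singleton.1 this
    exact ⟨c, hc.symm⟩
  induction a using UniformSpace.Completion.induction_on with
  | hp => exact S.closed_of_finiteDimensional
  | ih a =>
    let ε : PreTPow α ι ≃ₗ[ℝ] ℝ := PiTensorProduct.isEmptyEquiv ι
    have ha : a = (ε a * (ε (preTprod α e))⁻¹) • preTprod α e := by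
      apply ε.injective
      have : ε (preTprod α e) = 1 := PiTensorProduct.isEmptyEquiv_apply_tprod ι e
      rw [map_smul, this]
      simp
    rw [ha, UniformSpace.Completion.coe_smul]
    exact S.smul_mem _ (Submodule.mem_span_singleton_self _)

theorem tmul_preTprod_of_isEmpty [IsEmpty ι] (e : ι → E) (b : TPow α κ) :
    tmul α ((preTprod α e : PreTPow α ι) : TPow α ι) b =
      reindex α (Equiv.emptySum ι κ).symm b := by
  induction b using UniformSpace.Completion.induction_on with
  | hp => exact isClosed_eq (by fun_prop) (by fun_prop)
  | ih b =>
    rw [tmul_coe, reindex, ContinuousLinearMap.completion_apply_coe]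
    congr 1
    have h : preTmul α (preTprod α e) =
        (preReindex α (Equiv.emptySum ι κ).symm).toLinearMap := by
      refine preTPow_ext α fun e' => ?_
      rw [preTmul_tprod, ContinuousLinearMap.coe_coe, preReindex_tprod]
      congr 1
      funext i
      rcases i with i | i
      · exact isEmptyElim i
      · rfl
    exact LinearMap.congr_fun h b

/-- Merging with a tree without non-root vertices changes nothing. -/
def RTree.mergeIsEmpty [IsEmpty ι] (t : RTree ι) (s : RTree κ) : (t.merge s).Iso s where
  toEquiv := Equiv.emptySum ι κ
  map_rel_iff' := by
    rintro (a | a) (b | b)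
    · exact isEmptyElim a
    · exact isEmptyElim a
    · exact isEmptyElim b
    · rfl

/-- The counit property: only the trivial splitting contributes if the first tree is trivial. -/
theorem coproductGL_of_deg_eq_zero (g : TreeAlg α) {t : Tr} (ht : t.deg = 0) (s : Tr) :
    coproductGL α g t s =
      haveI : IsEmpty (Fin t.deg) := by rw [ht]; infer_instance
      reindex α (Equiv.emptySum (Fin t.deg) (Fin s.deg)).symm (g s).1 := by
  classical
  have : IsEmpty (Fin t.deg) := by rw [ht]; infer_instance
  have key : ∀ u : Tr, ∀ I : Set u.rep.RootChild,
      splitTo α u.rep (u.rep.above I) t.rep s.rep (g u).1 =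
        if u = s ∧ I = ∅ then reindex α (Equiv.emptySum (Fin t.deg) (Fin s.deg)).symm (g s).1
        else 0 := by
    intro u I
    have hiso : (Nonempty ((u.rep.restrict (u.rep.above I)).Iso t.rep) ∧
          Nonempty ((u.rep.restrict (u.rep.above I)ᶜ).Iso s.rep)) ↔ u = s ∧ I = ∅ := by
      constructor
      · rintro ⟨⟨φ⟩, ⟨ψ⟩⟩
        refine ⟨RTree.rep_injective ⟨(RTree.splitIso I φ ψ).trans (RTree.mergeIsEmpty _ _)⟩, ?_⟩
        refine Set.eq_empty_of_forall_notMem fun c hc => ?_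
        exact isEmptyElim (φ ⟨c.1, c, hc, u.rep.refl _⟩)
      · rintro ⟨rfl, rfl⟩
        have h0 : u.rep.above ∅ = ∅ := by simp [RTree.above]
        have : IsEmpty (u.rep.above ∅) := by rw [h0]; infer_instance
        refine ⟨⟨⟨Equiv.equivOfIsEmpty _ _, fun {a} => isEmptyElim a⟩⟩,
          ⟨⟨Equiv.subtypeUnivEquiv fun v => ?_, fun {a b} => Iff.rfl⟩⟩⟩
        rw [h0]
        exact Set.mem_compl (Set.notMem_empty v)
    have hconst : ∀ (φ : (u.rep.restrict (u.rep.above I)).Iso t.rep)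
        (ψ : (u.rep.restrict (u.rep.above I)ᶜ).Iso s.rep),
        reindex α ((Equiv.Set.sumCompl (u.rep.above I)).symm.trans
          (Equiv.sumCongr φ.toEquiv ψ.toEquiv)) (g u).1 =
          reindex α (Equiv.emptySum (Fin t.deg) (Fin s.deg)).symm (g s).1 := by
      intro φ ψ
      obtain ⟨rfl, -⟩ := hiso.1 ⟨⟨φ⟩, ⟨ψ⟩⟩
      apply reindex_injective α (Equiv.emptySum (Fin t.deg) (Fin u.deg))
      rw [reindex_reindex, reindex_reindex, Equiv.symm_trans_self, reindex_refl]
      exact reindex_of_mem_treePow α (g u).2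
        ((RTree.splitIso I φ ψ).trans (RTree.mergeIsEmpty _ _))
    simp only [splitTo, smul_apply, sum_apply]
    refine (average_const _ hconst).trans ?_
    simp only [hiso]
  simp only [coproductGL, key]
  rw [Fintype.sum_eq_single (⟨s, by omega⟩ : TrLE (t.deg + s.deg)), Finset.sum_eq_single ∅]
  · simp
  · intro I _ hI
    simp [hI]
  · simp
  · intro u hu
    refine Finset.sum_eq_zero fun I _ => if_neg fun h => hu (Subtype.ext h.1)

/-- The component of degree zero of a group-like element is the unit. -/
theorem IsGroupLike.eq_one {g : TreeAlg α} (hg : IsGroupLike α g) {t : Tr} (ht : t.deg = 0) :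
    (g t).1 = ((preTprod α 0 : PreTPow α (Fin t.deg)) : TPow α (Fin t.deg)) := by
  have : IsEmpty (Fin t.deg) := by rw [ht]; infer_instance
  obtain ⟨c, hc⟩ := exists_smul_preTprod_of_isEmpty α 0 (g t).1
  obtain ⟨s, hs⟩ := Function.ne_iff.1 hg.1
  have h := hg.2 t s
  rw [coproductGL_of_deg_eq_zero α g ht, hc, map_smul, smul_apply,
    tmul_preTprod_of_isEmpty] at h
  have hne : reindex α (Equiv.emptySum (Fin t.deg) (Fin s.deg)).symm (g s).1 ≠ 0 := by
    rw [← map_zero (reindex α (Equiv.emptySum (Fin t.deg) (Fin s.deg)).symm)]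
    exact fun h => hs (Subtype.ext (reindex_injective α _ h))
  have hc1 : c = 1 := by
    have h' : (1 - c) • reindex α (Equiv.emptySum (Fin t.deg) (Fin s.deg)).symm (g s).1 = 0 := by
      rw [sub_smul, one_smul, ← h, sub_self]
    exact (sub_eq_zero.1 ((smul_eq_zero.1 h').resolve_right hne)).symm
  rw [hc, hc1, one_smul]

end Normalisation

theorem psiTree_of_deg_eq_zero {E : Type u} {F : Type v} {G : Type w} [NormedAddCommGroup E]
    [NormedSpace ℝ E] [NormedAddCommGroup F] [NormedSpace ℝ F] [NormedAddCommGroup G]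
    [NormedSpace ℝ G] [CompleteSpace G] (α : CrossNorms E) (V : VectorFields E F) {f : F → G}
    (hf : ContDiff ℝ (⊤ : ℕ∞) f) {y : F} {g : TreeAlg α} (hg : IsGroupLike α g) {t : Tr}
    (ht : t.deg = 0) (h : PsiBdd α V f y t.rep) : psiTree α V f y t.rep (g t).1 = f y := by
  rw [hg.eq_one α ht, psiTree_coe α V h, prePsi_tprod, elemDiff_of_rootDeg_eq_zero V y hf]
  rw [RTree.rootDeg_eq_zero_iff, ht]
  infer_instance

/-! ### Elementary differentials are bounded on compact sets -/

section Bounds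

variable {E : Type u} {F : Type v} {G : Type w} [NormedAddCommGroup E] [NormedSpace ℝ E]
  [NormedAddCommGroup F] [NormedSpace ℝ F] [NormedAddCommGroup G] [NormedSpace ℝ G]
  {ι : Type} [Finite ι] (α : CrossNorms E) (V : VectorFields E F)

theorem exists_norm_iteratedFDeriv_le {f : F → G} (hf : ContDiff ℝ (⊤ : ℕ∞) f) {K : Set F}
    (hK : IsCompact K) (k : ℕ) : ∃ C, ∀ y ∈ K, ‖iteratedFDeriv ℝ k f y‖ ≤ C :=
  hK.exists_bound_of_continuousOn
    (hf.continuous_iteratedFDeriv (by exact_mod_cast le_top)).continuousOn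

/-- A multilinear map bounded by `C` on unit balls is bounded. -/
theorem norm_multilinear_le {κ : Type*} [Fintype κ] (m : MultilinearMap ℝ (fun _ : κ => E) G)
    {C : ℝ} (h : ∀ e : κ → E, (∀ i, ‖e i‖ ≤ 1) → ‖m e‖ ≤ C) (e : κ → E) :
    ‖m e‖ ≤ C * ∏ i, ‖e i‖ := by
  have he : e = fun i => ‖e i‖ • (‖e i‖⁻¹ • e i) := by
    funext i
    by_cases hi : e i = 0
    · simp [hi]
    · rw [smul_inv_smul₀ (norm_ne_zero_iff.2 hi)]
  conv_lhs => rw [he]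
  rw [m.map_smul_univ, norm_smul, Real.norm_of_nonneg (by positivity), mul_comm]
  gcongr
  refine h _ fun i => ?_
  rw [norm_smul, norm_inv, norm_norm]
  exact inv_mul_le_one

/-- Each directional derivative of the vector fields is continuous in the label: it is a pointwise
limit of difference quotients. -/
theorem exists_clm_iteratedFDeriv [CompleteSpace E] (k : ℕ) : ∀ (y : F) (z : Fin k → F),
    ∃ L : E →L[ℝ] F, ∀ e, L e = iteratedFDeriv ℝ k (V.toLin e) y z := by
  induction k with
  | zero =>
    intro y z
    refine ⟨⟨(LinearMap.proj y).comp V.toLin, ?_⟩, fun e => ?_⟩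
    · exact V.continuous.comp (continuous_id.prodMk continuous_const)
    · rw [iteratedFDeriv_zero_apply]
      rfl
  | succ k ih =>
    intro y z
    choose L hL using fun x => ih x (Fin.tail z)
    let q : ℕ → E →L[ℝ] F := fun n => (n : ℝ) • (L (y + (n : ℝ)⁻¹ • z 0) - L y)
    have hq : Filter.Tendsto (fun n e => q n e) Filter.atTop
        (𝓝 fun e => iteratedFDeriv ℝ (k + 1) (V.toLin e) y z) := by
      refine tendsto_pi_nhds.2 fun e => ?_
      rw [iteratedFDeriv_succ_eq_fderiv_apply (V.smooth e)]
      have hd := ((contDiff_iteratedFDeriv_apply (V.smooth e) k (Fin.tail z)).contDiffAt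
        (x := y)).differentiableAt (by simp)
      have := hd.hasFDerivAt.lim (z 0) (c := fun n : ℕ => (n : ℝ)) (l := Filter.atTop)
        (by simpa using tendsto_natCast_atTop_atTop)
      refine this.congr fun n => ?_
      simp [q, hL]
    exact ⟨continuousLinearMapOfTendsto q hq, fun e => rfl⟩

/-- By the uniform boundedness principle, the derivatives of the vector fields are bounded uniformly
on compact sets. -/
theorem VectorFields.exists_bound [CompleteSpace E] {K : Set F} (hK : IsCompact K) (k : ℕ) :
    ∃ C, ∀ e, ∀ y ∈ K, ∀ z : Fin k → F,
      ‖iteratedFDeriv ℝ k (V.toLin e) y z‖ ≤ C * ‖e‖ * ∏ i, ‖z i‖ := by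
  choose L hL using exists_clm_iteratedFDeriv V k
  obtain ⟨C, hC⟩ := banach_steinhaus
    (g := fun q : {q : F × (Fin k → F) // q.1 ∈ K ∧ ∀ i, ‖q.2 i‖ ≤ 1} => L q.1.1 q.1.2) (by
      intro e
      obtain ⟨C, hC⟩ := exists_norm_iteratedFDeriv_le (V.smooth e) hK k
      refine ⟨C, fun q => ?_⟩
      rw [hL]
      refine (ContinuousMultilinearMap.le_opNorm _ _).trans ?_
      refine (mul_le_of_le_one_right (norm_nonneg _) ?_).trans (hC _ q.2.1)
      exact Finset.prod_le_one (fun _ _ => norm_nonneg _) fun i _ => q.2.2 i)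
  refine ⟨C, fun e y hy z => ?_⟩
  refine norm_multilinear_le (iteratedFDeriv ℝ k (V.toLin e) y).toMultilinearMap (fun z hz => ?_) z
  change ‖iteratedFDeriv ℝ k (V.toLin e) y z‖ ≤ _
  rw [← hL]
  exact (L y z).le_of_opNorm_le (hC ⟨(y, z), hy, hz⟩) e

theorem exists_norm_vertexVec_le [CompleteSpace E] {K : Set F} (hK : IsCompact K) (t : RTree ι)
    (a : ι) : ∃ C, ∀ y ∈ K, ∀ e : ι → E, (∀ i, ‖e i‖ ≤ 1) → ‖vertexVec V y t e a‖ ≤ C := by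
  induction a using t.wf_gt.induction with
  | h a ih =>
    choose! C hC using ih
    obtain ⟨B, hB⟩ := V.exists_bound hK (Nat.card {c // t.IsChild a c})
    refine ⟨max B 0 * ∏ i, max (C ((Finite.equivFin {c // t.IsChild a c}).symm i).1) 0,
      fun y hy e he => ?_⟩
    rw [vertexVec_eq]
    refine (hB _ y hy _).trans ?_
    have h₁ : B * ‖e a‖ ≤ max B 0 :=
      (mul_le_mul_of_nonneg_right (le_max_left B 0) (norm_nonneg _)).trans
        (mul_le_of_le_one_right (le_max_right B 0) (he a))
    refine mul_le_mul h₁ (Finset.prod_le_prod (fun _ _ => norm_nonneg _) fun i _ => ?_)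
      (Finset.prod_nonneg fun _ _ => norm_nonneg _) (le_max_right B 0)
    exact (hC _ ((Finite.equivFin {c // t.IsChild a c}).symm i).2.1 y hy e he).trans
      (le_max_left _ _)

/-- Uniform boundedness of the elementary differentials of `f` of degree at most `N` over the base
points in `K`. -/
def PsiBddOn (N : ℕ) (f : F → G) (K : Set F) : Prop :=
  ∀ t : TrLE N, ∃ C : ℝ, ∀ y ∈ K, ∀ a : PreTPow α (Fin t.1.deg),
    ‖prePsi α V f y t.1.rep a‖ ≤ C * ‖a‖

theorem PsiBddOn.psiBdd {α : CrossNorms E} {V : VectorFields E F} {N : ℕ} {f : F → G} {K : Set F}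
    (h : PsiBddOn α V N f K) {y : F} (hy : y ∈ K) (t : TrLE N) : PsiBdd α V f y t.1.rep := by
  obtain ⟨C, hC⟩ := h t
  exact ⟨C, hC y hy⟩

theorem psiBddOn_of_projectiveAt [CompleteSpace E] {N : ℕ} (hα : ∀ k ≤ N, α.ProjectiveAt k)
    {f : F → G} (hf : ContDiff ℝ (⊤ : ℕ∞) f) {K : Set F} (hK : IsCompact K) :
    PsiBddOn α V N f K := by
  intro t
  obtain ⟨A, hA⟩ := hα t.1.deg t.2
  obtain ⟨B, hB⟩ := exists_norm_iteratedFDeriv_le hf hK (Nat.card {c // t.1.rep.IsRootChild c})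
  choose C hC using exists_norm_vertexVec_le V hK t.1.rep
  let D := max B 0 * ∏ i, max (C ((Finite.equivFin {c // t.1.rep.IsRootChild c}).symm i).1) 0
  have hD : 0 ≤ D := by positivity
  refine ⟨D * A, fun y hy a => ?_⟩
  have hm : ∀ e : Fin t.1.deg → E, (∀ i, ‖e i‖ ≤ 1) →
      ‖elemDiffMulti V f y t.1.rep e‖ ≤ D := by
    intro e he
    refine (ContinuousMultilinearMap.le_opNorm _ _).trans ?_
    refine mul_le_mul ((hB y hy).trans (le_max_left _ _))
      (Finset.prod_le_prod (fun _ _ => norm_nonneg _) fun i _ => ?_)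
      (Finset.prod_nonneg fun _ _ => norm_nonneg _) (le_max_right B 0)
    exact (hC _ y hy e he).trans (le_max_left _ _)
  let M := (elemDiffMulti V f y t.1.rep).mkContinuous D (norm_multilinear_le _ hm)
  have hM : ‖M‖ ≤ D := MultilinearMap.mkContinuous_norm_le _ hD _
  calc ‖prePsi α V f y t.1.rep a‖
      ≤ ‖M‖ * PiTensorProduct.projectiveSeminorm (𝕜 := ℝ) (E := fun _ : Fin t.1.deg => E) a :=
        PiTensorProduct.norm_eval_le_projectiveSeminorm M a
    _ ≤ D * (A * ‖a‖) := mul_le_mul hM (hA a) (apply_nonneg _ _) hD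
    _ = D * A * ‖a‖ := (mul_assoc _ _ _).symm

end Bounds

section BoundsUniverse

variable {E : Type u} {F : Type v} {G : Type (max v w)} [NormedAddCommGroup E] [NormedSpace ℝ E]
  [NormedAddCommGroup F] [NormedSpace ℝ F] [NormedAddCommGroup G] [NormedSpace ℝ G]
  [CompleteSpace G] (α : CrossNorms E) (V : VectorFields E F)

theorem psiBddOn_of_psiBounded {N : ℕ} (hα : PsiBounded.{u, v, w} α V N) {f : F → G}
    (hf : ContDiff ℝ (⊤ : ℕ∞) f) {K : Set F} (hK : IsCompact K) : PsiBddOn α V N f K := by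
  intro t
  refine hK.induction_on (p := fun s => ∃ C : ℝ, ∀ y ∈ s, ∀ a : PreTPow α (Fin t.1.deg),
    ‖prePsi α V f y t.1.rep a‖ ≤ C * ‖a‖) ⟨0, by simp⟩ ?_ ?_ ?_
  · rintro s s' hs ⟨C, hC⟩
    exact ⟨C, fun y hy => hC y (hs hy)⟩
  · rintro s s' ⟨C, hC⟩ ⟨C', hC'⟩
    refine ⟨max C C', ?_⟩
    rintro y (hy | hy) a
    · exact (hC y hy a).trans (mul_le_mul_of_nonneg_right (le_max_left _ _) (norm_nonneg _))
    · exact (hC' y hy a).trans (mul_le_mul_of_nonneg_right (le_max_right _ _) (norm_nonneg _))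
  · intro y₀ _
    obtain ⟨C, hC⟩ := hα G f hf t y₀
    exact ⟨_, mem_nhdsWithin_of_mem_nhds hC, C, fun y hy => hy⟩

theorem psiBddOn_of_or [CompleteSpace E] {N : ℕ}
    (hα : (∀ k ≤ N, α.ProjectiveAt k) ∨ PsiBounded.{u, v, w} α V N) {f : F → G}
    (hf : ContDiff ℝ (⊤ : ℕ∞) f) {K : Set F} (hK : IsCompact K) : PsiBddOn α V N f K :=
  hα.elim (fun h => psiBddOn_of_projectiveAt α V h hf hK)
    fun h => psiBddOn_of_psiBounded.{u, v, w} α V h hf hK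

end BoundsUniverse

/-! ### Linear isometries of the target -/

section Isometry

variable {E : Type u} {F : Type v} {G : Type w} {H : Type*} [NormedAddCommGroup E]
  [NormedSpace ℝ E] [NormedAddCommGroup F] [NormedSpace ℝ F] [NormedAddCommGroup G]
  [NormedSpace ℝ G] [NormedAddCommGroup H] [NormedSpace ℝ H]
  (α : CrossNorms E) (V : VectorFields E F)

theorem prePsi_isometry {ι : Type} [Finite ι] (L : G ≃ₗᵢ[ℝ] H) (f : F → G) (y : F) (t : RTree ι)
    (a : PreTPow α ι) : prePsi α V (L ∘ f) y t a = L (prePsi α V f y t a) := by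
  have : prePsi α V (L ∘ f) y t = (L.toLinearEquiv : G →ₗ[ℝ] H).comp (prePsi α V f y t) := by
    refine preTPow_ext α fun e => ?_
    change prePsi α V (L ∘ f) y t (preTprod α e) = L (prePsi α V f y t (preTprod α e))
    rw [prePsi_tprod, prePsi_tprod, elemDiff, elemDiff, derivAlong, derivAlong]
    have := L.toContinuousLinearEquiv.iteratedFDeriv_comp_left (f := f) (x := y)
      (i := Nat.card {c // t.IsRootChild c})
    exact DFunLike.congr_fun this _
  exact LinearMap.congr_fun this a

theorem psiBddOn_isometry_iff (L : G ≃ₗᵢ[ℝ] H) (N : ℕ) (f : F → G) (K : Set F) :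
    PsiBddOn α V N (L ∘ f) K ↔ PsiBddOn α V N f K := by
  simp only [PsiBddOn, prePsi_isometry, L.norm_map]

theorem Psi_isometry [CompleteSpace G] [CompleteSpace H] (L : G ≃ₗᵢ[ℝ] H) {N : ℕ} {f : F → G}
    {y : F} (h : ∀ t : TrLE N, PsiBdd α V f y t.1.rep) (x : TruncTreeAlg α N) :
    Psi α V (L ∘ f) y x = L (Psi α V f y x) := by
  rw [Psi, Psi, map_sum]
  refine Fintype.sum_congr _ _ fun t => ?_
  have h' : PsiBdd α V (L ∘ f) y t.1.rep := by
    obtain ⟨C, hC⟩ := h t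
    exact ⟨C, fun a => by rw [prePsi_isometry, L.norm_map]; exact hC a⟩
  induction (x t).1 using UniformSpace.Completion.induction_on with
  | hp => exact isClosed_eq (by fun_prop) (L.continuous.comp (by fun_prop))
  | ih a => rw [psiTree_coe α V h', psiTree_coe α V (h t), prePsi_isometry]

end Isometry

/-! ### Expansion of elementary differentials in powers of the increment -/

section Expansion

variable {E : Type u} {F : Type v} [NormedAddCommGroup E] [NormedSpace ℝ E]
  [NormedAddCommGroup F] [NormedSpace ℝ F] (α : CrossNorms E) (V : VectorFields E F)

open Classical in
/-- The increment `Ψ_{V,id,y}(g) - y`: the contribution of the trees whose root has one child. -/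
def psiIncrement [CompleteSpace F] (N : ℕ) (y : F) (g : TreeAlg α) : F :=
  ∑ t : TrLE N, if t.1.rep.rootDeg = 1 then psiTree α V id y t.1.rep (g t.1).1 else 0

variable {α V}

/-- There is exactly one tree of degree zero. -/
theorem sum_deg_eq_zero {M : Type*} [AddCommMonoid M] (N : ℕ) {h : TrLE N → M} {X : M}
    (h0 : ∀ t : TrLE N, t.1.deg = 0 → h t = X) (h1 : ∀ t : TrLE N, t.1.deg ≠ 0 → h t = 0) :
    ∑ t : TrLE N, h t = X := by
  let e : RTree (Fin 0) := ⟨fun _ _ => True, by simp, by simp, fun a => a.elim0, by simp⟩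
  obtain ⟨t₀, ⟨φ⟩⟩ := e.exists_iso_rep
  have ht₀ : t₀.deg = 0 := by simpa using (Nat.card_congr φ.toEquiv).symm
  rw [Fintype.sum_eq_single (⟨t₀, by omega⟩ : TrLE N), h0 _ ht₀]
  intro t ht
  refine h1 t fun htd => ht (Subtype.ext (RTree.rep_injective ?_))
  have i₁ : IsEmpty (Fin t.1.deg) := by rw [htd]; infer_instance
  have i₂ : IsEmpty (Fin t₀.deg) := by rw [ht₀]; infer_instance
  exact ⟨⟨Equiv.equivOfIsEmpty _ _, fun {a} => i₁.elim a⟩⟩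

theorem rep_rootDeg_eq_zero_iff {t : Tr} : t.rep.rootDeg = 0 ↔ t.deg = 0 := by
  rw [RTree.rootDeg_eq_zero_iff, ← Finite.card_eq_zero_iff, Nat.card_fin]

theorem psiPart_zero {G : Type w} [NormedAddCommGroup G] [NormedSpace ℝ G] [CompleteSpace G]
    {N : ℕ} {f : F → G} (hf : ContDiff ℝ (⊤ : ℕ∞) f) {y : F}
    (hB : ∀ u : TrLE N, PsiBdd α V f y u.1.rep) {g : TreeAlg α} (hg : IsGroupLike α g) (L : ℕ) :
    psiPart α V N f y g 0 L = if 0 < L then f y else 0 := by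
  refine sum_deg_eq_zero N (fun t ht => ?_) fun t ht => ?_
  · simp only [psiTree_of_deg_eq_zero α V hf hg ht (hB t), rep_rootDeg_eq_zero_iff, ht, true_and]
  · exact if_neg fun h => ht (rep_rootDeg_eq_zero_iff.1 h.1)

theorem rootDeg_rep_le (t : Tr) : t.rep.rootDeg ≤ t.deg :=
  (Nat.card_le_card_of_injective _ (Subtype.val_injective (p := t.rep.IsRootChild))).trans_eq
    (Nat.card_fin _)

theorem Psi_trunc_eq_sum {G : Type w} [NormedAddCommGroup G] [NormedSpace ℝ G] [CompleteSpace G]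
    (N : ℕ) (f : F → G) (y : F) (g : TreeAlg α) :
    Psi α V f y (trunc α N g) = ∑ m ∈ Finset.range (N + 1), psiPart α V N f y g m (N + 1) := by
  classical
  simp only [psiPart]
  rw [Finset.sum_comm, Psi]
  refine Fintype.sum_congr _ _ fun t => ?_
  have h₁ := t.2
  have h₂ := rootDeg_rep_le t.1
  rw [Finset.sum_eq_single t.1.rep.rootDeg]
  · rw [if_pos ⟨rfl, by omega⟩]
    rfl
  · exact fun m _ hm => if_neg fun h => hm h.1.symm
  · exact fun h => (h (Finset.mem_range.2 (by omega))).elim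

theorem Psi_id_trunc [CompleteSpace F] {N : ℕ} {y : F} (hid : ∀ u : TrLE N, PsiBdd α V id y u.1.rep)
    {g : TreeAlg α} (hg : IsGroupLike α g) :
    Psi α V id y (trunc α N g) = y + psiIncrement α V N y g := by
  classical
  have h0 : ∑ t : TrLE N, (if t.1.deg = 0 then y else 0) = y :=
    sum_deg_eq_zero N (fun t ht => if_pos ht) fun t ht => if_neg ht
  rw [Psi, psiIncrement]
  refine Eq.trans ?_ (congrArg (· + _) h0)
  rw [← Finset.sum_add_distrib]
  refine Fintype.sum_congr _ _ fun t => ?_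
  change psiTree α V id y t.1.rep (g t.1).1 = _
  by_cases ht : t.1.deg = 0
  · rw [psiTree_of_deg_eq_zero α V contDiff_id hg ht (hid t), if_pos ht,
      rep_rootDeg_eq_zero_iff.2 ht]
    simp
  · have ht' : t.1.rep.rootDeg ≠ 0 := fun h => ht (rep_rootDeg_eq_zero_iff.1 h)
    by_cases h1 : t.1.rep.rootDeg = 1
    · simp [ht, h1]
    · rw [psiTree_eq_zero α V (elemDiff_id_of_two_le V y (by omega))]
      simp [ht, h1]

/-- The component of `g` over each non-trivial tree of degree at most `N` is bounded by the power of
`h` given by the degree. The increments of a rough path satisfy this for `h = ω(s,t)^{1/p}`. -/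
def HasScale (N : ℕ) (g : TreeAlg α) (h : ℝ) : Prop :=
  ∀ t : TrLE N, 1 ≤ t.1.deg → ‖(g t.1).1‖ ≤ h ^ t.1.deg

theorem exists_norm_psiTree_id_le [CompleteSpace F] {N : ℕ} {K : Set F}
    (hid : PsiBddOn α V N id K) :
    ∃ B, 0 ≤ B ∧ ∀ y ∈ K, ∀ g : TreeAlg α, ∀ h : ℝ, 0 ≤ h → HasScale N g h →
      ∀ t : TrLE N, t.1.rep.rootDeg = 1 →
        ‖psiTree α V id y t.1.rep (g t.1).1‖ ≤ B * h ^ t.1.deg := by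
  choose C hC using hid
  refine ⟨∑ t, |C t|, Finset.sum_nonneg fun _ _ => abs_nonneg _, fun y hy g h hh hg t ht => ?_⟩
  have hdeg : 1 ≤ t.1.deg := ht ▸ rootDeg_rep_le t.1
  refine (norm_psiTree_le α V (hC t y hy) _).trans ?_
  refine mul_le_mul ((le_abs_self _).trans ?_) (hg t hdeg) (norm_nonneg _)
    (Finset.sum_nonneg fun _ _ => abs_nonneg _)
  exact Finset.single_le_sum (f := fun t => |C t|) (fun _ _ => abs_nonneg _) (Finset.mem_univ t)

theorem exists_norm_psiIncrement_le [CompleteSpace F] {N : ℕ} {K : Set F}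
    (hid : PsiBddOn α V N id K) :
    ∃ B, 0 ≤ B ∧ ∀ y ∈ K, ∀ g : TreeAlg α, ∀ h : ℝ, 0 ≤ h → h ≤ 1 → HasScale N g h →
      ‖psiIncrement α V N y g‖ ≤ B * h := by
  classical
  obtain ⟨B, hB0, hB⟩ := exists_norm_psiTree_id_le hid
  refine ⟨∑ _t : TrLE N, B, Finset.sum_nonneg fun _ _ => hB0, fun y hy g h hh hh1 hg => ?_⟩
  rw [Finset.sum_mul]
  refine norm_sum_le_of_le _ fun t _ => ?_
  split_ifs with ht
  · refine (hB y hy g h hh hg t ht).trans (mul_le_mul_of_nonneg_left ?_ hB0)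
    exact pow_le_of_le_one hh hh1 (by have := rootDeg_rep_le t.1; omega)
  · rw [norm_zero]
    positivity

/-- For a group-like element, the part of `Ψ_{V,f,y}` with `m` branches at the root agrees, up to
terms of degree at least `L`, with the `m`-th Taylor term of `f` in the direction of the increment.
Boundedness is assumed for all smooth maps because the induction passes from `f` to `fderiv ℝ f`. -/
theorem exists_norm_psiPart_sub_le [CompleteSpace F] {N : ℕ} {K : Set F} (hK : IsCompact K)
    (hB : ∀ (G : Type (max v w)) [NormedAddCommGroup G] [NormedSpace ℝ G] [CompleteSpace G]
      (f : F → G), ContDiff ℝ (⊤ : ℕ∞) f → PsiBddOn α V N f K)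
    (hid : PsiBddOn α V N id K) (m : ℕ) :
    ∀ (G : Type (max v w)) [NormedAddCommGroup G] [NormedSpace ℝ G] [CompleteSpace G]
      (f : F → G), ContDiff ℝ (⊤ : ℕ∞) f → ∃ C, 0 ≤ C ∧ ∀ y ∈ K, ∀ g : TreeAlg α,
        IsGroupLike α g → ∀ h : ℝ, 0 ≤ h → h ≤ 1 → HasScale N g h → ∀ L ≤ N + 1,
        ‖psiPart α V N f y g m L -
          (m.factorial : ℝ)⁻¹ • iteratedFDeriv ℝ m f y fun _ => psiIncrement α V N y g‖ ≤
            C * h ^ L := by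
  classical
  induction m with
  | zero =>
    intro G _ _ _ f hf
    obtain ⟨C, hC⟩ := exists_norm_iteratedFDeriv_le hf hK 0
    refine ⟨|C|, abs_nonneg _, fun y hy g hg h hh hh1 hgh L _ => ?_⟩
    rw [psiPart_zero hf (fun u => (hB G f hf).psiBdd hy u) hg]
    rcases Nat.eq_zero_or_pos L with rfl | hL
    · have := (norm_iteratedFDeriv_zero (𝕜 := ℝ) (f := f) (x := y)) ▸ hC y hy
      simpa using this.trans (le_abs_self C)
    · simp only [hL, if_true, Nat.factorial_zero, Nat.cast_one, inv_one, one_smul,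
        iteratedFDeriv_zero_apply, sub_self, norm_zero]
      positivity
  | succ m ih =>
    intro G _ _ _ f hf
    have hf' := contDiff_top_fderiv hf
    obtain ⟨C, hC0, hC⟩ := ih (F →L[ℝ] G) (fderiv ℝ f) hf'
    obtain ⟨B, hB0, hBid⟩ := exists_norm_psiTree_id_le hid
    refine ⟨∑ _t : TrLE N, C * B, Finset.sum_nonneg fun _ _ => by positivity,
      fun y hy g hg h hh hh1 hgh L hL => ?_⟩
    set Z := psiIncrement α V N y g with hZ
    set X := psiPart α V N f y g (m + 1) L - ((m + 1).factorial : ℝ)⁻¹ •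
      iteratedFDeriv ℝ (m + 1) f y fun _ => Z with hX
    have hrec := psiPart_succ α V hf (fun u => (hB G f hf).psiBdd hy u)
      (fun u => hid.psiBdd hy u) (fun u => (hB _ _ hf').psiBdd hy u) hg m L hL
    have hD : iteratedFDeriv ℝ (m + 1) f y (fun _ => Z) = ∑ t : TrLE N,
        if t.1.rep.rootDeg = 1 then (iteratedFDeriv ℝ m (fderiv ℝ f) y fun _ => Z)
          (psiTree α V id y t.1.rep (g t.1).1) else 0 := by
      rw [iteratedFDeriv_succ_apply_right]
      change (iteratedFDeriv ℝ m (fderiv ℝ f) y fun _ => Z) Z = _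
      conv_lhs => rw [hZ, psiIncrement, map_sum]
      refine Fintype.sum_congr _ _ fun t => ?_
      split_ifs
      · rfl
      · exact map_zero _
    have hfac : ((m + 1 : ℕ) : ℝ) * ((m + 1).factorial : ℝ)⁻¹ = (m.factorial : ℝ)⁻¹ := by
      rw [Nat.factorial_succ, Nat.cast_mul, mul_inv, mul_inv_cancel_left₀]
      exact_mod_cast Nat.succ_ne_zero m
    have hsum : ((m + 1 : ℕ) : ℝ) • X = ∑ t : TrLE N, if t.1.rep.rootDeg = 1 then
        (psiPart α V N (fderiv ℝ f) y g m (L - t.1.deg) - (m.factorial : ℝ)⁻¹ •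
          iteratedFDeriv ℝ m (fderiv ℝ f) y fun _ => Z)
          (psiTree α V id y t.1.rep (g t.1).1) else 0 := by
      rw [hX, smul_sub, smul_smul, hfac, Nat.cast_smul_eq_nsmul, hrec, hD, Finset.smul_sum,
        ← Finset.sum_sub_distrib]
      refine Fintype.sum_congr _ _ fun t => ?_
      split_ifs
      · rfl
      · simp
    have hle : ‖X‖ ≤ ‖((m + 1 : ℕ) : ℝ) • X‖ := by
      rw [norm_smul]
      refine le_mul_of_one_le_left (norm_nonneg _) ?_
      rw [Real.norm_natCast]
      exact_mod_cast Nat.succ_pos m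
    refine hle.trans ?_
    rw [hsum, Finset.sum_mul]
    refine norm_sum_le_of_le _ fun t _ => ?_
    split_ifs with ht
    · refine (ContinuousLinearMap.le_opNorm _ _).trans ?_
      refine (mul_le_mul (hC y hy g hg h hh hh1 hgh (L - t.1.deg) (by omega))
        (hBid y hy g h hh hgh t ht) (norm_nonneg _) (by positivity)).trans ?_
      rw [mul_mul_mul_comm, ← pow_add]
      -- the exponent is at least `L`, also when the truncated difference `L - deg t` vanishes
      exact mul_le_mul_of_nonneg_left (pow_le_pow_of_le_one hh hh1 (by omega)) (by positivity)
    · rw [norm_zero]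
      positivity

end Expansion

/-! ### Taylor expansion near a compact set -/

section Taylor

theorem exists_bound_near_compact {F M : Type*} [NormedAddCommGroup F]
    [SeminormedAddCommGroup M] {φ : F → M} (hφ : Continuous φ) {K : Set F} (hK : IsCompact K) :
    ∃ δ > 0, ∃ C, 0 ≤ C ∧ ∀ y ∈ K, ∀ z, ‖z - y‖ < δ → ‖φ z‖ ≤ C := by
  obtain ⟨C, hC⟩ := hK.exists_bound_of_continuousOn hφ.continuousOn
  have hU : IsOpen {z | ‖φ z‖ < |C| + 1} := isOpen_lt hφ.norm continuous_const
  obtain ⟨δ, hδ, hsub⟩ := hK.exists_thickening_subset_open hU fun y hy => by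
    have := hC y hy
    have := le_abs_self C
    change ‖φ y‖ < |C| + 1
    linarith
  refine ⟨δ, hδ, |C| + 1, by positivity, fun y hy z hz => ?_⟩
  have : z ∈ Metric.thickening δ K :=
    Metric.mem_thickening_iff.2 ⟨y, hy, by rwa [dist_eq_norm]⟩
  exact (hsub this).le

variable {F : Type v} {G : Type w} [NormedAddCommGroup F] [NormedSpace ℝ F]
  [NormedAddCommGroup G] [NormedSpace ℝ G]

theorem exists_lipschitz_near_compact {f : F → G} (hf : ContDiff ℝ (⊤ : ℕ∞) f) {K : Set F}
    (hK : IsCompact K) : ∃ δ > 0, ∃ C, 0 ≤ C ∧ ∀ y ∈ K, ∀ a b, ‖a - y‖ < δ → ‖b - y‖ < δ →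
      ‖f a - f b‖ ≤ C * ‖a - b‖ := by
  obtain ⟨δ, hδ, C, hC0, hC⟩ := exists_bound_near_compact (contDiff_top_fderiv hf).continuous hK
  refine ⟨δ, hδ, C, hC0, fun y hy a b ha hb => ?_⟩
  refine (convex_ball y δ).norm_image_sub_le_of_norm_fderiv_le (𝕜 := ℝ)
    (fun x _ => (hf.differentiable (by simp)).differentiableAt)
    (fun x hx => hC y hy x (by rwa [← dist_eq_norm])) ?_ ?_
  · rwa [Metric.mem_ball, dist_eq_norm]
  · rwa [Metric.mem_ball, dist_eq_norm]

theorem exists_taylor_near_compact [CompleteSpace G] {f : F → G} (hf : ContDiff ℝ (⊤ : ℕ∞) f)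
    {K : Set F} (hK : IsCompact K) (N : ℕ) : ∃ δ > 0, ∃ C, 0 ≤ C ∧ ∀ y ∈ K, ∀ z, ‖z‖ < δ →
      ‖f (y + z) - ∑ k ∈ Finset.range (N + 1),
        (k.factorial : ℝ)⁻¹ • iteratedFDeriv ℝ k f y fun _ => z‖ ≤ C * ‖z‖ ^ (N + 1) := by
  obtain ⟨δ, hδ, C, hC0, hC⟩ := exists_bound_near_compact
    (hf.continuous_iteratedFDeriv (m := N + 1) (by exact_mod_cast le_top)) hK
  refine ⟨δ, hδ, C, hC0, fun y hy z hz => ?_⟩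
  rw [map_add_eq_sum_add_integral_iteratedFDeriv (n := N)
    fun t _ => hf.contDiffAt.of_le (by exact_mod_cast le_top), add_sub_cancel_left, norm_smul]
  have hfac : ‖((N.factorial : ℝ))⁻¹‖ ≤ 1 := by
    rw [norm_inv, Real.norm_natCast]
    exact inv_le_one_of_one_le₀ (by exact_mod_cast Nat.factorial_pos N)
  refine (mul_le_of_le_one_left (norm_nonneg _) hfac).trans ?_
  refine (intervalIntegral.norm_integral_le_of_norm_le_const (C := C * ‖z‖ ^ (N + 1))
    fun t ht => ?_).trans_eq (by simp)
  rw [Set.uIoc_of_le zero_le_one] at ht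
  have h₁ : ‖(1 - t) ^ N‖ ≤ 1 := by
    rw [norm_pow, Real.norm_of_nonneg (by linarith [ht.2])]
    exact pow_le_one₀ (by linarith [ht.2]) (by linarith [ht.1])
  rw [norm_smul]
  refine (mul_le_of_le_one_left (norm_nonneg _) h₁).trans ?_
  refine (ContinuousMultilinearMap.le_opNorm _ _).trans ?_
  rw [Finset.prod_const, Finset.card_univ, Fintype.card_fin]
  refine mul_le_mul_of_nonneg_right (hC y hy _ ?_) (by positivity)
  rw [add_sub_cancel_left, norm_smul, Real.norm_of_nonneg ht.1.le]
  exact (mul_le_of_le_one_left (norm_nonneg _) ht.2).trans_lt hz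

end Taylor

/-! ### The local estimate -/

section Main

variable {E : Type u} {F : Type v} [NormedAddCommGroup E] [NormedSpace ℝ E]
  [NormedAddCommGroup F] [NormedSpace ℝ F] {α : CrossNorms E} {V : VectorFields E F}

/-- For group-like elements, `Ψ_{V,f,y}` differs from the value of `f` at `Ψ_{V,id,y}` only by terms
of degree exceeding the truncation level. -/
theorem exists_norm_sub_Psi_le [CompleteSpace F] {N : ℕ} {K : Set F} (hK : IsCompact K)
    (hB : ∀ (G : Type (max v w)) [NormedAddCommGroup G] [NormedSpace ℝ G] [CompleteSpace G]
      (f : F → G), ContDiff ℝ (⊤ : ℕ∞) f → PsiBddOn α V N f K)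
    (hid : PsiBddOn α V N id K) {G : Type (max v w)} [NormedAddCommGroup G] [NormedSpace ℝ G]
    [CompleteSpace G] {f : F → G} (hf : ContDiff ℝ (⊤ : ℕ∞) f) :
    ∃ δ > 0, ∃ C, 0 ≤ C ∧ ∀ y ∈ K, ∀ g : TreeAlg α, IsGroupLike α g → ∀ h : ℝ, 0 ≤ h → h ≤ 1 →
      h < δ → HasScale N g h →
        ‖f (Psi α V id y (trunc α N g)) - Psi α V f y (trunc α N g)‖ ≤ C * h ^ (N + 1) := by
  obtain ⟨B, hB0, hZ⟩ := exists_norm_psiIncrement_le hid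
  obtain ⟨δ, hδ, A, hA0, hA⟩ := exists_taylor_near_compact hf hK N
  choose C hC0 hC using fun m => exists_norm_psiPart_sub_le hK hB hid m G f hf
  refine ⟨δ / (B + 1), by positivity, A * B ^ (N + 1) + ∑ m ∈ Finset.range (N + 1), C m,
    add_nonneg (by positivity) (Finset.sum_nonneg fun m _ => hC0 m), ?_⟩
  intro y hy g hg h hh hh1 hhδ hgh
  have hZh := hZ y hy g h hh hh1 hgh
  have hZδ : ‖psiIncrement α V N y g‖ < δ := by
    rw [lt_div_iff₀ (by positivity)] at hhδ
    nlinarith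
  rw [Psi_id_trunc (fun u => hid.psiBdd hy u) hg, Psi_trunc_eq_sum]
  refine (norm_sub_le_norm_sub_add_norm_sub _ (∑ m ∈ Finset.range (N + 1),
    (m.factorial : ℝ)⁻¹ • iteratedFDeriv ℝ m f y fun _ => psiIncrement α V N y g) _).trans ?_
  rw [add_mul]
  refine add_le_add ((hA y hy _ hZδ).trans ?_) ?_
  · rw [mul_assoc, ← mul_pow]
    gcongr
  · rw [← Finset.sum_sub_distrib, Finset.sum_mul]
    refine norm_sum_le_of_le _ fun m _ => ?_
    rw [norm_sub_rev]
    exact hC m y hy g hg h hh hh1 hgh (N + 1) le_rfl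

theorem exists_norm_Psi_le {G : Type w} [NormedAddCommGroup G] [NormedSpace ℝ G] [CompleteSpace G]
    {N : ℕ} {K : Set F} {f : F → G} (hB : PsiBddOn α V N f K) :
    ∃ C, 0 ≤ C ∧ ∀ y ∈ K, ∀ (x : TruncTreeAlg α N) (A : ℝ), (∀ t, ‖x t‖ ≤ A) →
      ‖Psi α V f y x‖ ≤ C * A := by
  choose C hC using hB
  refine ⟨∑ t, |C t|, Finset.sum_nonneg fun _ _ => abs_nonneg _, fun y hy x A hA => ?_⟩
  rw [Psi, Finset.sum_mul]
  refine norm_sum_le_of_le _ fun t _ => (norm_psiTree_le α V (hC t y hy) _).trans ?_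
  exact mul_le_mul (le_abs_self _) (hA t) (norm_nonneg _) (abs_nonneg _)

theorem isCompact_simplex (T : ℝ) : IsCompact (simplex T) := by
  refine (isCompact_Icc.prod isCompact_Icc : IsCompact (Set.Icc 0 T ×ˢ Set.Icc 0 T))
    |>.of_isClosed_subset ?_ fun q hq => ⟨⟨hq.1, hq.2.1.trans hq.2.2⟩, hq.1.trans hq.2.1, hq.2.2⟩
  exact (isClosed_le continuous_const continuous_fst).inter
    ((isClosed_le continuous_fst continuous_snd).inter
      (isClosed_le continuous_snd continuous_const))

/-- A function that is `o(h)` near zero may be prescribed away from zero, and at zero. -/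
theorem tendsto_ite_div {θ : ℝ → ℝ} (hθ : Filter.Tendsto (fun h => θ h / h) (𝓝[≠] 0) (𝓝 0))
    {A B q η M : ℝ} (hq : 1 < q) (hη : 0 < η) :
    Filter.Tendsto (fun h => (if 0 < |h| ∧ |h| < η then A * |θ h| + B * |h| ^ q else M) / h)
      (𝓝[≠] 0) (𝓝 0) := by
  have hlim : Filter.Tendsto (fun h : ℝ => |A| * |θ h / h| + |B| * |h| ^ (q - 1)) (𝓝[≠] 0)
      (𝓝 0) := by
    have h₁ : Filter.Tendsto (fun h : ℝ => |h| ^ (q - 1)) (𝓝[≠] 0) (𝓝 0) := by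
      have : ContinuousAt (fun h : ℝ => |h| ^ (q - 1)) 0 :=
        continuous_abs.continuousAt.rpow_const (Or.inr (by linarith))
      have h := this.tendsto
      rw [abs_zero, Real.zero_rpow (by linarith)] at h
      exact h.mono_left nhdsWithin_le_nhds
    simpa using (hθ.abs.const_mul |A|).add (h₁.const_mul |B|)
  refine squeeze_zero_norm' ?_ hlim
  have hη' : ∀ᶠ h : ℝ in 𝓝[≠] 0, |h| < η :=
    nhdsWithin_le_nhds (by simpa [Metric.ball, Real.dist_eq] using Metric.ball_mem_nhds (0 : ℝ) hη)
  filter_upwards [hη', self_mem_nhdsWithin] with h hh hne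
  have hpos : 0 < |h| := abs_pos.2 hne
  rw [if_pos ⟨hpos, hh⟩, norm_div, Real.norm_eq_abs, Real.norm_eq_abs, div_le_iff₀ hpos, add_mul,
    abs_div, mul_assoc, mul_assoc, div_mul_cancel₀ _ hpos.ne', ← Real.rpow_add_one hpos.ne',
    sub_add_cancel]
  refine (abs_add_le _ _).trans_eq ?_
  rw [abs_mul, abs_mul, abs_abs, abs_of_nonneg (Real.rpow_nonneg hpos.le q)]

end Main

section Equivalence

variable {E : Type u} {F : Type v} [NormedAddCommGroup E] [NormedSpace ℝ E]
  [NormedAddCommGroup F] [NormedSpace ℝ F] [CompleteSpace F] {α : CrossNorms E}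
  {V : VectorFields E F}

theorem hasScale_of_isBranchedRoughPath {T p : ℝ} {ω : ℝ → ℝ → ℝ} (hω : IsControl T ω)
    {x : ℝ → ℝ → TruncTreeAlg α ⌊p⌋₊} (hx : IsBranchedRoughPath α T p ω x) {s t : ℝ}
    (hs : 0 ≤ s) (hst : s ≤ t) (ht : t ≤ T) {g : TreeAlg α} (hg : x s t = trunc α ⌊p⌋₊ g) :
    HasScale ⌊p⌋₊ g (ω s t ^ (1 / p)) := by
  intro τ hτ
  have := hx.bound s t hs hst ht τ.1.deg hτ τ.2 τ rfl
  rw [hg] at this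
  rw [← Real.rpow_mul_natCast (hω.nonneg s t hs hst ht), div_mul_eq_mul_div, one_mul]
  exact this

/-- The implication from the expansion of `y` to that of `f ∘ y`. Where `ω(s,t)` vanishes or is not
small, the remainder is only bounded, by compactness. -/
theorem exists_remainder_of_id {T p : ℝ} (hp : 1 ≤ p) {ω : ℝ → ℝ → ℝ} (hω : IsControl T ω)
    {x : ℝ → ℝ → TruncTreeAlg α ⌊p⌋₊} (hx : IsBranchedRoughPath α T p ω x) {y : ℝ → F}
    (hy : ContinuousOn y (Set.Icc 0 T))
    (hB : ∀ (G : Type (max v w)) [NormedAddCommGroup G] [NormedSpace ℝ G] [CompleteSpace G]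
      (f : F → G), ContDiff ℝ (⊤ : ℕ∞) f → PsiBddOn α V ⌊p⌋₊ f (y '' Set.Icc 0 T))
    (hid : PsiBddOn α V ⌊p⌋₊ id (y '' Set.Icc 0 T)) {θ : ℝ → ℝ}
    (hθ : Filter.Tendsto (fun h => θ h / h) (𝓝[≠] 0) (𝓝 0))
    (hyθ : ∀ s t, 0 ≤ s → s ≤ t → t ≤ T →
      ‖y t - Psi α V (id : F → F) (y s) (x s t)‖ ≤ θ (ω s t))
    {G : Type (max v w)} [NormedAddCommGroup G] [NormedSpace ℝ G] [CompleteSpace G] {f : F → G}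
    (hf : ContDiff ℝ (⊤ : ℕ∞) f) :
    ∃ θ : ℝ → ℝ, Filter.Tendsto (fun h => θ h / h) (𝓝[≠] 0) (𝓝 0) ∧
      ∀ s t, 0 ≤ s → s ≤ t → t ≤ T → ‖f (y t) - Psi α V f (y s) (x s t)‖ ≤ θ (ω s t) := by
  have hp0 : 0 < p := by linarith
  set K := y '' Set.Icc 0 T
  have hK : IsCompact K := isCompact_Icc.image_of_continuousOn hy
  obtain ⟨δ₁, hδ₁, C, hC0, hC⟩ := exists_norm_sub_Psi_le hK hB hid hf
  obtain ⟨δ₂, hδ₂, A, hA0, hA⟩ := exists_lipschitz_near_compact hf hK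
  obtain ⟨B, hB0, hZ⟩ := exists_norm_psiIncrement_le hid
  -- the crude bound
  obtain ⟨M₁, hM₁⟩ := hK.exists_bound_of_continuousOn hf.continuous.continuousOn
  obtain ⟨M₂, -, hM₂⟩ := exists_norm_Psi_le (hB G f hf)
  obtain ⟨X, hX⟩ := (isCompact_simplex T).exists_bound_of_continuousOn
    (f := fun q τ => ‖x q.1 q.2 τ‖) (continuousOn_pi.2 fun τ =>
      ((continuous_apply τ).comp_continuousOn hx.continuousOn).norm)
  have hbig : ∀ s t, 0 ≤ s → s ≤ t → t ≤ T →
      ‖f (y t) - Psi α V f (y s) (x s t)‖ ≤ M₁ + M₂ * X := by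
    intro s t hs hst ht
    refine (norm_sub_le _ _).trans (add_le_add (hM₁ _ ⟨t, ⟨hs.trans hst, ht⟩, rfl⟩)
      (hM₂ _ ⟨s, ⟨hs, hst.trans ht⟩, rfl⟩ _ _ fun τ => ?_))
    have h₁ := norm_le_pi_norm (fun τ => ‖x s t τ‖) τ
    rw [norm_norm] at h₁
    exact h₁.trans (hX (s, t) ⟨hs, hst, ht⟩)
  -- the range in which the control is small
  obtain ⟨η, hη, hsmall⟩ : ∃ η > 0, ∀ r : ℝ, 0 < |r| → |r| < η →
      |θ r| < δ₂ / 2 ∧ |r| ^ (1 / p) < min (min 1 δ₁) (δ₂ / 2 / (B + 1)) := by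
    have h₁ : Filter.Tendsto (fun r => |θ r|) (𝓝[≠] 0) (𝓝 0) := by
      have h := (hθ.mul (tendsto_nhdsWithin_of_tendsto_nhds Filter.tendsto_id)).abs
      rw [mul_zero, abs_zero] at h
      refine h.congr' ?_
      filter_upwards [self_mem_nhdsWithin] with r hr
      rw [id, div_mul_cancel₀ _ hr]
    have h₂ : Filter.Tendsto (fun r : ℝ => |r| ^ (1 / p)) (𝓝[≠] 0) (𝓝 0) := by
      have : ContinuousAt (fun r : ℝ => |r| ^ (1 / p)) 0 :=
        continuous_abs.continuousAt.rpow_const (Or.inr (by positivity))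
      have h := this.tendsto
      rw [abs_zero, Real.zero_rpow (by positivity)] at h
      exact h.mono_left nhdsWithin_le_nhds
    have h₃ := (h₁.eventually (gt_mem_nhds (show 0 < δ₂ / 2 by positivity))).and
      (h₂.eventually (gt_mem_nhds (show 0 < min (min 1 δ₁) (δ₂ / 2 / (B + 1)) by positivity)))
    obtain ⟨η, hη, h⟩ := Metric.eventually_nhds_iff.1 (eventually_nhdsWithin_iff.1 h₃)
    exact ⟨η, hη, fun r hr hrη => h (by rwa [Real.dist_eq, sub_zero]) (abs_pos.1 hr)⟩
  have hq : 1 < ((⌊p⌋₊ + 1 : ℕ) : ℝ) / p := by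
    rw [one_lt_div hp0, Nat.cast_add, Nat.cast_one]
    exact Nat.lt_floor_add_one p
  refine ⟨_, tendsto_ite_div hθ (A := A) (B := C) (M := M₁ + M₂ * X) hq hη, ?_⟩
  intro s t hs hst ht
  split_ifs with hr
  · obtain ⟨g, hg, hxg⟩ := hx.groupLike s t hs hst ht
    obtain ⟨hr₁, hr₂⟩ := hsmall _ hr.1 hr.2
    have habs : |ω s t| = ω s t := abs_of_nonneg (hω.nonneg s t hs hst ht)
    have hgs := hasScale_of_isBranchedRoughPath hω hx hs hst ht hxg
    have hyK : y s ∈ K := ⟨s, ⟨hs, hst.trans ht⟩, rfl⟩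
    rw [habs] at hr₂ ⊢
    set h := ω s t ^ (1 / p) with hh
    have hh0 : 0 ≤ h := Real.rpow_nonneg (hω.nonneg s t hs hst ht) _
    rw [lt_min_iff, lt_min_iff, lt_div_iff₀ (by positivity)] at hr₂
    obtain ⟨⟨hh1, hhδ⟩, hhB⟩ := hr₂
    have hpow : ω s t ^ (((⌊p⌋₊ + 1 : ℕ) : ℝ) / p) = h ^ (⌊p⌋₊ + 1) := by
      rw [hh, ← Real.rpow_mul_natCast (hω.nonneg s t hs hst ht), div_mul_eq_mul_div, one_mul]
    have hΨ : ‖y t - Psi α V id (y s) (x s t)‖ ≤ |θ (ω s t)| :=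
      (hyθ s t hs hst ht).trans (le_abs_self _)
    have hΨ' : ‖Psi α V id (y s) (x s t) - y s‖ < δ₂ / 2 := by
      rw [hxg, Psi_id_trunc (fun u => hid.psiBdd hyK u) hg, add_sub_cancel_left]
      refine (hZ _ hyK g h hh0 hh1.le hgs).trans_lt ?_
      nlinarith
    have hyt : ‖y t - y s‖ < δ₂ := by
      have := norm_sub_le_norm_sub_add_norm_sub (y t) (Psi α V id (y s) (x s t)) (y s)
      linarith
    refine (norm_sub_le_norm_sub_add_norm_sub _ (f (Psi α V id (y s) (x s t))) _).trans ?_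
    refine add_le_add ((hA _ hyK _ _ hyt (by linarith)).trans ?_) ?_
    · exact mul_le_mul_of_nonneg_left hΨ hA0
    · rw [hpow, hxg]
      exact hC _ hyK g hg h hh0 hh1.le hhδ hgs
  · exact hbig s t hs hst ht

end Equivalence

end BranchedRough

end

theorem mainTheorem1 {E : Type u} {F : Type v}
    [NormedAddCommGroup E] [NormedSpace ℝ E] [CompleteSpace E]
    [NormedAddCommGroup F] [NormedSpace ℝ F] [CompleteSpace F]
    (α : BranchedRough.CrossNorms E) (V : BranchedRough.VectorFields E F)
    (T p : ℝ) (hT : 0 < T) (hp : 1 ≤ p)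
    (hα : (∀ k ≤ ⌊p⌋₊, α.ProjectiveAt k) ∨ BranchedRough.PsiBounded.{u, v, w} α V ⌊p⌋₊)
    (ω : ℝ → ℝ → ℝ) (hω : BranchedRough.IsControl T ω)
    (x : ℝ → ℝ → BranchedRough.TruncTreeAlg α ⌊p⌋₊)
    (hx : BranchedRough.IsBranchedRoughPath α T p ω x)
    (y : ℝ → F) (hy : ContinuousOn y (Set.Icc 0 T)) :
    (∃ θ : ℝ → ℝ, Filter.Tendsto (fun h => θ h / h) (𝓝[≠] 0) (𝓝 0) ∧
      ∀ s t, 0 ≤ s → s ≤ t → t ≤ T →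
        ‖y t - BranchedRough.Psi α V (id : F → F) (y s) (x s t)‖ ≤ θ (ω s t)) ↔
    (∀ (G : Type (max v w)) [NormedAddCommGroup G] [NormedSpace ℝ G] [CompleteSpace G]
      (f : F → G), ContDiff ℝ (⊤ : ℕ∞) f →
      ∃ θ : ℝ → ℝ, Filter.Tendsto (fun h => θ h / h) (𝓝[≠] 0) (𝓝 0) ∧
        ∀ s t, 0 ≤ s → s ≤ t → t ≤ T →
          ‖f (y t) - BranchedRough.Psi α V f (y s) (x s t)‖ ≤ θ (ω s t)) := by
  have hK : IsCompact (y '' Set.Icc 0 T) := isCompact_Icc.image_of_continuousOn hy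
  have hB : ∀ (G : Type (max v w)) [NormedAddCommGroup G] [NormedSpace ℝ G] [CompleteSpace G]
      (f : F → G), ContDiff ℝ (⊤ : ℕ∞) f →
        BranchedRough.PsiBddOn α V ⌊p⌋₊ f (y '' Set.Icc 0 T) := fun G _ _ _ f hf =>
    BranchedRough.psiBddOn_of_or.{u, v, w} α V hα hf hK
  -- `F` itself need not live in the universe over which `G` ranges, but a copy of it does
  let L : F ≃ₗᵢ[ℝ] ULift.{w} F := (LinearIsometryEquiv.ulift ℝ F).symm
  have hL : ContDiff ℝ (⊤ : ℕ∞) (L ∘ (id : F → F)) := L.contDiff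
  have : CompleteSpace (ULift.{w} F) :=
    (completeSpace_congr (e := L.toEquiv) L.isometry.isUniformEmbedding).1 inferInstance
  have hid : BranchedRough.PsiBddOn α V ⌊p⌋₊ (id : F → F) (y '' Set.Icc 0 T) :=
    (BranchedRough.psiBddOn_isometry_iff α V L _ id _).1 (hB _ _ hL)
  constructor
  · rintro ⟨θ, hθ, hyθ⟩ G _ _ _ f hf
    exact BranchedRough.exists_remainder_of_id hp hω hx hy hB hid hθ hyθ hf
  · intro h
    obtain ⟨θ, hθ, hyθ⟩ := h _ _ hL
    refine ⟨θ, hθ, fun s t hs hst ht => ?_⟩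
    have := hyθ s t hs hst ht
    rw [BranchedRough.Psi_isometry α V L
      (fun u => hid.psiBdd ⟨s, ⟨hs, hst.trans ht⟩, rfl⟩ u)] at this
    change ‖L (y t) - _‖ ≤ _ at this
    rwa [← map_sub, L.norm_map] at this
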